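/- **Setting.** Let $W$ be a discrete-time memoryless channel given by conditional densities $p_{Y|X}(y|x)$ with respect to a $\sigma$-finite reference measure on the output alphabet (counting measure: PMF; Lebesgue measure: PDF), let $\mathcal C=\sup_{p}I(p)$ be its capacity in nats, where $p$ ranges over the input distributions, and put $$E_0(\rho,p)=-\log\int\Big(\int p_{Y|X}(y|x)^{\frac1{1+\rho}}\,dp(x)\Big)^{1+\rho}dy,\qquad E_x(\rho,p)=-\rho\log\iint\Big(\int\sqrt{p_{Y|X}(y|x)\,p_{Y|X}(y|x')}\,dy\Big)^{1/\rho}dp(x)\,dp(x').$$ With $R_x(p)=\partial_\rho E_x(\rho,p)|_{\rho=1}$ and $R_{crit}(p)=\partial_\rho E_0(\rho,p)|_{\rho=1}$, let $E_L(R,p)$ be $\sup_{\rho\ge1}\{-\rho R+E_x(\rho,p)\}$ if $R\le R_x(p)$, $-R+E_0(1,p)$ if $R_x(p)<R\le R_{crit}(p)$, and $\sup_{0\le\rho\le1}\{-\rho R+E_0(\rho,p)\}$ if $R>R_x(p)$ and $R>R_{crit}(p)$. Gallager's exponent is $E(R)=\sup_pE_L(R,p)$ and Forney's exponent is $E_c(R)=\sup_{r_o\in[R/\mathcal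 C,1],\,r_o>0}(1-r_o)E(R/r_o)$; values in $[0,\infty]$, with $0\cdot\infty=0$. **Scheme.** Let $\varepsilon_1>0$ and $\varepsilon_2>0$ with $1/\varepsilon_2$ an integer. The inner code is a map from an alphabet of $q$ symbols to channel input words of length $N_i$. The outer code is any code of length $N_o$ over that alphabet, of rate at least $r_o$, with an errors-and-erasures decoder that corrects $t$ errors and $d$ erasures whenever $2t+d<N_o(1-r_o-\varepsilon_1)$; $N=N_oN_i$. For every position $i\le N_o$ the inner decoder forwards the maximum-likelihood decision $\hat x_i$ and the reliability weight $\alpha_i=\min\{1,\max\{0,L_i/(2T)\}\}$, where $L_i$ is the logarithm of the likelihood of $\hat x_i$ divided by the sum of the likelihoods of all other symbols ($\alpha_i=1$ if that sum is $0$) and $T=T_{N_i}>0$ is a clipping level. For an outer codeword $x$ let $\alpha\cdot x=\sum_i\alpha_is_i$, with $s_i=1$ if $\hat x_i=x_i$ and $s_i=-1$ otherwise. For each integer $0\le k<1/\varepsilon_2$ the revised GMD decoder erases the positions with $\alpha_i\le k\varepsilon_2$ that are among the $N_o(1-r_o-\varepsilon_1)$ least reliable ones (those whose rank in the ascending order of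 the weights is at most this number) and runs the errors-and-erasures decoder; it outputs, among the codewords obtained, one that maximises $\alpha\cdot x$. **Theorem 3.** Let $0<R<\mathcal C$. For outer rates $r_o\in[R/\mathcal C,1]$, $r_o>0$, consider the following property $B(r_o,\varepsilon_1,\varepsilon_2,e)$, where $e\in\mathbb R$. For every sequence $q_{N_i}$ with $\frac1{N_i}\log q_{N_i}\to R/r_o$ there are inner codes with $q_{N_i}$ codewords of length $N_i$ that achieve Gallager's exponent (for every real $E'<E(R/r_o)$ and all large $N_i$, each inner message has maximum-likelihood error probability at most $e^{-N_iE'}$), and clipping levels with $T_{N_i}/N_i\to E(R/r_o)$, such that for all sufficiently large $N_i$, every $N_o$, every outer code as above, and every transmitted outer codeword $x_m$, the error probability $P_e$ of the revised GMD decoder satisfies $$P_e\le P\Big\{\alpha\cdot x_m\le N_o\Big(\tfrac{\varepsilon_2}2+(r_o+\varepsilon_1)\big(1-\tfrac{\varepsilon_2}2\big)\Big)\Big\}\le\exp[-N\,e].$$ Then there is a real function $e(\varepsilon_1,\varepsilon_2)$ with $e(\varepsilon_1,\varepsilon_2)\to E_c(R)$ as $\varepsilon_1,\varepsilon_2\to0^+$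 (that is, $e=E_c(R)-\varepsilon$ with $\varepsilon\to0$ if $E_c(R)<\infty$), such that for all $\varepsilon_1,\varepsilon_2$ as above there is an outer rate $r_o\in[R/\mathcal C,1]$, $r_o>0$, with $B(r_o,\varepsilon_1,\varepsilon_2,e(\varepsilon_1,\varepsilon_2))$. Moreover for each fixed outer rate $r_o\in[R/\mathcal C,1]$, $r_o>0$ (for instance a maximiser in $E_c(R)$, if there is one) there is such a function $e$ with limit $(1-r_o)E(R/r_o)$ for which $B(r_o,\varepsilon_1,\varepsilon_2,e(\varepsilon_1,\varepsilon_2))$ holds for all $\varepsilon_1,\varepsilon_2$ as above. -/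

import Mathlib

open MeasureTheory ProbabilityTheory Filter Topology Set
open scoped ENNReal NNReal

noncomputable section

/-- A memoryless channel from `X` to `Y`, given by a conditional density `w x y = p(y|x)` with
respect to a σ-finite reference measure on the output alphabet.  The counting measure gives
conditional probability mass functions, Lebesgue measure on `ℝ` gives conditional probability
density functions. -/
structure MemorylessChannel (X Y : Type*) [MeasurableSpace X] [MeasurableSpace Y] where
  ref : Measure Y
  sigmaFinite_ref : SigmaFinite ref
  w : X → Y → ℝ≥0
  measurable_w : Measurable (Function.uncurry w)
  lintegral_w : ∀ x, ∫⁻ y, (w x y : ℝ≥0∞) ∂ref = 1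

namespace MemorylessChannel

variable {X Y : Type*} [MeasurableSpace X] [MeasurableSpace Y] (W : MemorylessChannel X Y)

instance : SigmaFinite W.ref := W.sigmaFinite_ref

/-- The law of the output given the input, as a Markov kernel. -/
def kernel : Kernel X Y :=
  Kernel.withDensity (Kernel.const X W.ref) (fun x y => (W.w x y : ℝ≥0∞))

lemma kernel_apply (x : X) :
    W.kernel x = W.ref.withDensity (fun y => (W.w x y : ℝ≥0∞)) := by
  have h : Measurable (Function.uncurry fun x y => (W.w x y : ℝ≥0∞)) :=
    W.measurable_w.coe_nnreal_ennreal
  rw [kernel, Kernel.withDensity_apply _ h, Kernel.const_apply]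

instance : IsMarkovKernel W.kernel :=
  ⟨fun x => ⟨by
    rw [kernel_apply, withDensity_apply _ MeasurableSet.univ, Measure.restrict_univ]
    exact W.lintegral_w x⟩⟩

/-- Mutual information (in nats) between input and output for the input distribution `p`. -/
def mutualInfo (p : ProbabilityMeasure X) : ℝ≥0∞ :=
  InformationTheory.klDiv ((p : Measure X) ⊗ₘ W.kernel)
    ((p : Measure X).prod (W.kernel ∘ₘ (p : Measure X)))

/-- Shannon capacity (in nats per channel use). -/
def capacity : ℝ≥0∞ := ⨆ p : ProbabilityMeasure X, W.mutualInfo p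

/-- Gallager's function `E₀(ρ, p)`. -/
def E0 (p : ProbabilityMeasure X) (ρ : ℝ) : ℝ :=
  -Real.log (∫⁻ y, (∫⁻ x, (W.w x y : ℝ≥0∞) ^ (1 / (1 + ρ)) ∂(p : Measure X)) ^ (1 + ρ)
    ∂W.ref).toReal

/-- Gallager's expurgated function `E_x(ρ, p)`. -/
def Ex (p : ProbabilityMeasure X) (ρ : ℝ) : ℝ :=
  -ρ * Real.log (∫⁻ x, ∫⁻ x', (∫⁻ y, ((W.w x y : ℝ≥0∞) * (W.w x' y : ℝ≥0∞)) ^ (1 / 2 : ℝ)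
    ∂W.ref) ^ (1 / ρ) ∂(p : Measure X) ∂(p : Measure X)).toReal

/-- The critical rate `R_crit = ∂E₀/∂ρ` at `ρ = 1`. -/
def Rcrit (p : ProbabilityMeasure X) : ℝ := derivWithin (W.E0 p) (Icc 0 1) 1

/-- The expurgation rate `R_x = ∂E_x/∂ρ` at `ρ = 1`. -/
def Rx (p : ProbabilityMeasure X) : ℝ := derivWithin (W.Ex p) (Ici 1) 1

open Classical in
/-- Gallager's exponent `E_L(R, p)` for a given input distribution: expurgated, straight-line and
random-coding part. -/
def EL (R : ℝ) (p : ProbabilityMeasure X) : EReal :=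
  if R ≤ W.Rx p then ⨆ ρ ∈ Ici (1 : ℝ), ((-ρ * R + W.Ex p ρ : ℝ) : EReal)
  else if R ≤ W.Rcrit p then ((-R + W.E0 p 1 : ℝ) : EReal)
  else ⨆ ρ ∈ Icc (0 : ℝ) 1, ((-ρ * R + W.E0 p ρ : ℝ) : EReal)

/-- Gallager's error exponent `E(R)`, optimised over the input distribution. -/
def gallagerExponent (R : ℝ) : EReal := ⨆ p : ProbabilityMeasure X, W.EL R p

/-- `r` is an outer rate in `[R / 𝒞, 1]` (and positive, which matters only if `𝒞 = ∞`). -/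
def IsOuterRate (R r : ℝ) : Prop :=
  0 < r ∧ r ≤ 1 ∧ ENNReal.ofReal R ≤ ENNReal.ofReal r * W.capacity

/-- Forney's exponent `E_c(R) = sup_{r ∈ [R/𝒞, 1]} (1 - r) E(R / r)`. -/
def forneyExponent (R : ℝ) : EReal :=
  ⨆ r ∈ {r : ℝ | W.IsOuterRate R r}, ((1 - r : ℝ) : EReal) * W.gallagerExponent (R / r)

/-- The law of the received block when the block `x` is sent. -/
def blockLaw {n : ℕ} (x : Fin n → X) : Measure (Fin n → Y) :=
  Measure.pi fun j => W.kernel (x j)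

/-- The likelihood `p(y | x)` of a block. -/
def lik {n : ℕ} (x : Fin n → X) (y : Fin n → Y) : ℝ≥0 := ∏ j, W.w (x j) (y j)

/-- `dec` is a maximum-likelihood decoder of the code `enc` (ties are broken arbitrarily). -/
def IsMLDecoder {n q : ℕ} (enc : Fin q → Fin n → X) (dec : (Fin n → Y) → Fin q) : Prop :=
  Measurable dec ∧ ∀ y a, W.lik (enc a) y ≤ W.lik (enc (dec y)) y

/-- The codes `enc n`, of length `n` with `q n` messages, achieve the error exponent `E`: under
maximum-likelihood decoding every message has error probability at most `exp (-n (E - o(1)))`. -/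
def AchievesExponent (q : ℕ → ℕ) (enc : ∀ n, Fin (q n) → Fin n → X) (E : EReal) : Prop :=
  ∀ E' : ℝ, (E' : EReal) < E → ∀ᶠ n : ℕ in atTop, ∀ dec, W.IsMLDecoder (enc n) dec →
    ∀ a, W.blockLaw (enc n a) {y | dec y ≠ a} ≤ ENNReal.ofReal (Real.exp (-(n * E')))

open Classical in
/-- Forney's reliability weight of an inner decision: with the log-likelihood ratio
`L = log (p(y | x̂) / ∑_{a ≠ x̂} p(y | a))` of the decision `x̂` against all other messages, the
weight is `L / (2T)`, clipped to `[0, 1]` (and `1` if `L = ∞`). -/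
def reliability {n q : ℕ} (enc : Fin q → Fin n → X) (T : ℝ) (dec : (Fin n → Y) → Fin q)
    (y : Fin n → Y) : ℝ :=
  let others : ℝ≥0 := ∑ a ∈ Finset.univ.erase (dec y), W.lik (enc a) y
  if others = 0 then 1
  else max 0 (min 1 (Real.log ((W.lik (enc (dec y)) y : ℝ) / others) / (2 * T)))

end MemorylessChannel

open Classical in
/-- The dot product `α · x = ∑ α_i s(x̂_i, x_i)` with `s = 1` for agreement, `-1` otherwise. -/
def gmdDot {q N : ℕ} (α : Fin N → ℝ) (xhat x : Fin N → Fin q) : ℝ :=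
  ∑ i, α i * (if x i = xhat i then 1 else -1)

open Classical in
/-- An outer code of length `N`, rate at least `r`, over an alphabet with `q` symbols, with an
errors-and-erasures decoder (`none` in the input is an erasure, `none` as output is a failure)
that corrects `t` errors and `d` erasures whenever `2 t + d < N (1 - r - ε)`. -/
structure NearMDSCode (q N : ℕ) (r ε : ℝ) where
  code : Set (Fin N → Fin q)
  rate : r * (N * Real.log q) ≤ Real.log code.ncard
  dec : (Fin N → Option (Fin q)) → Option code
  corrects : ∀ (c : code) (v : Fin N → Option (Fin q)),
    2 * ((Finset.univ.filter fun i => v i ≠ none ∧ v i ≠ some (c.1 i)).card : ℝ)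
      + ((Finset.univ.filter fun i => v i = none).card : ℝ) < N * (1 - r - ε) →
    dec v = some c

open Classical in
/-- The input of the `k`-th errors-and-erasures decoding: position `i` is erased if
`α_i ≤ k ε₂` and `α_i` is among the `N (1 - r - ε₁)` smallest weights. -/
def erasedWord {q N : ℕ} (r ε₁ ε₂ : ℝ) (k : ℕ) (xhat : Fin N → Fin q) (α : Fin N → ℝ) :
    Fin N → Option (Fin q) := fun i =>
  if α i ≤ k * ε₂ ∧ ((((Tuple.sort α).symm i : Fin N) : ℕ) + 1 : ℝ) ≤ N * (1 - r - ε₁) then none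
  else some (xhat i)

/-- `g` is a revised GMD decoder: it runs the errors-and-erasures decoder of the outer code for
every `0 ≤ k < 1 / ε₂` and outputs, among the codewords obtained, one that maximises `α · x`
(it fails only if every one of these decodings fails). -/
def IsRevisedGMD {q N : ℕ} {r ε₁ : ℝ} (C : NearMDSCode q N r ε₁) (ε₂ : ℝ)
    (g : (Fin N → Fin q) → (Fin N → ℝ) → Option C.code) : Prop :=
  ∀ xhat α,
    (g xhat α = none → ∀ k : ℕ, (k : ℝ) < 1 / ε₂ →
      C.dec (erasedWord r ε₁ ε₂ k xhat α) = none) ∧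
    ∀ c, g xhat α = some c →
      (∃ k : ℕ, (k : ℝ) < 1 / ε₂ ∧ C.dec (erasedWord r ε₁ ε₂ k xhat α) = some c) ∧
      ∀ (k : ℕ) (c' : C.code), (k : ℝ) < 1 / ε₂ →
        C.dec (erasedWord r ε₁ ε₂ k xhat α) = some c' →
        gmdDot α xhat c'.1 ≤ gmdDot α xhat c.1

/-- The law of the whole received word of the concatenated code when the outer codeword `x` is
sent: its symbols are encoded by the inner code and sent over the channel. -/
def concatLaw {X Y : Type*} [MeasurableSpace X] [MeasurableSpace Y] (W : MemorylessChannel X Y)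
    {n q N : ℕ} (enc : Fin q → Fin n → X) (x : Fin N → Fin q) : Measure (Fin N → Fin n → Y) :=
  Measure.pi fun i => W.blockLaw (enc (x i))

/-- The performance of one-level concatenation at overall rate `R` and outer rate `r`, with
exponent `e`.  For every choice of the numbers `q n` of inner codewords whose rate tends to `R / r`
there are inner codes that achieve Gallager's exponent at the rate `R / r`, and clipping levels
`T n = n (E(R / r) + o(1))` for the reliability weights, such that for all large inner lengths `n`,
all outer lengths `N` and all outer codes, every transmitted outer codeword satisfies
`P(error) ≤ P{α · x ≤ N (ε₂/2 + (r + ε₁)(1 - ε₂/2))} ≤ exp (-(N n) e)`. -/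
def ConcatenatedBound {X Y : Type*} [MeasurableSpace X] [MeasurableSpace Y]
    (W : MemorylessChannel X Y) (R r ε₁ ε₂ e : ℝ) : Prop :=
  ∀ q : ℕ → ℕ, Tendsto (fun n : ℕ => Real.log (q n) / n) atTop (𝓝 (R / r)) →
  ∃ (enc : ∀ n, Fin (q n) → Fin n → X) (T : ℕ → ℝ),
    W.AchievesExponent q enc (W.gallagerExponent (R / r)) ∧
    (∀ n, 0 < T n) ∧
    Tendsto (fun n : ℕ => ((T n / n : ℝ) : EReal)) atTop (𝓝 (W.gallagerExponent (R / r))) ∧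
    ∀ᶠ n in atTop, ∀ (dec : (Fin n → Y) → Fin (q n)), W.IsMLDecoder (enc n) dec →
    ∀ (N : ℕ) (C : NearMDSCode (q n) N r ε₁)
      (g : (Fin N → Fin (q n)) → (Fin N → ℝ) → Option C.code), IsRevisedGMD C ε₂ g →
    ∀ x : C.code,
      let xhat : (Fin N → Fin n → Y) → Fin N → Fin (q n) := fun y i => dec (y i)
      let α : (Fin N → Fin n → Y) → Fin N → ℝ :=
        fun y i => W.reliability (enc n) (T n) dec (y i)
      let P := concatLaw W (enc n) x.1
      let bad : Set (Fin N → Fin n → Y) :=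
        {y | gmdDot (α y) (xhat y) x.1 ≤ N * (ε₂ / 2 + (r + ε₁) * (1 - ε₂ / 2))}
      P {y | g (xhat y) (α y) ≠ some x} ≤ P bad ∧
      P bad ≤ ENNReal.ofReal (Real.exp (-((N * n : ℝ) * e)))

end

/-!
The whole argument rests on one condition on an inner code and its clipping level `T`,
`MemorylessChannel.HasMomentBound`: if `Z = ± α` is the reliability weight of an inner decision,
with the sign `+` exactly if the decision is correct, then `E exp (-T Z) ≤ 2 exp (-T)` for *every*
inner message and every maximum-likelihood decoder.  Since `Z ≤ 0` after a wrong decision, Markov's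
inequality gives the error probability `2 exp (-T)` of the inner code.  Since the blocks are
independent and `α · x` is the sum of the variables `Z`, the Chernoff bound at the parameter `T`
gives `P {α · x ≤ N s} ≤ exp (N (log 2 - T (1 - s)))`
(`MemorylessChannel.HasMomentBound.concatLaw_gmdDot_le`).  With `T ≈ n E(R / r)` and
`s = ε₂ / 2 + (r + ε₁) (1 - ε₂ / 2) → r` this is the exponent `(1 - r) E(R / r)` in the limit of
small `ε₁, ε₂`.  That the revised GMD decoder can only err if `α · x` is small is deterministic
(`IsRevisedGMD.eq_some`): the trapezoidal rule approximates each weight, up to `ε₂ / 2`, by a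
weighted count of the erasure thresholds below it, so that some threshold leaves a correctable word, and the minimum distance
of the outer code makes `x` the unique maximiser of the soft agreement.

Inner codes with `T = n t` have to be found for every `t < E(R / r)`.  Write `p_b` for the
likelihoods, `S_m = ∑_{b ≠ m} p_b` and `confusion x S = min x √(x S)`.  If `m` is sent and `a` is
decided, `p_m exp (-T Z)` is at most `p_m exp (-T)` plus the confusion of `m` with `S_m` plus, for
`a ≠ m`, the term `p_m min (exp T) √(p_a / S_a)`.

* In the expurgated range all these terms are dominated by the Bhattacharyya integrands
  `√(p_m p_b)`, and Gallager's expurgation of a random list applies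
  (`MemorylessChannel.exists_subcode_of_expurgation`).
* In the random-coding range the last term is not monotone in the code: removing words can
  increase it, so that discarding the bad half of a list does not suffice.  It is however comparable
  with the amount by which the total confusion of the code drops when `m` is removed.  For the
  code that minimises a total confusion plus a price for each missing word, every such drop is at
  most the price (`exists_subcode_of_confusion`).  Taking the sums of likelihoods in that potential
  with up to `i` terms removed (`trimmedSum`) makes the estimate robust against the deletion of a
  small random set of words, which adjusts the number of codewords to the prescribed one.

Finally `exists_tendsto_of_eventually_exists_ge` selects near-optimal exponents: once to let `t`
tend to `E(R / r)` with the block length, and once to obtain the function `e(ε₁, ε₂)`.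
-/

/-! ### Generalised minimum-distance decoding -/

/-- The erased positions of a threshold are the first positions in the order of the weights: if at
most `D` weights are at most `t`, then each of them has rank at most `D`. -/
lemma rank_le_of_card_le {N : ℕ} (α : Fin N → ℝ) {t D : ℝ}
    (hc : ((Finset.univ.filter fun i => α i ≤ t).card : ℝ) ≤ D) {i : Fin N} (hi : α i ≤ t) :
    ((((Tuple.sort α).symm i : Fin N) : ℕ) + 1 : ℝ) ≤ D := by
  refine le_trans ?_ hc
  set j := (Tuple.sort α).symm i with hj
  have hsub : (Finset.Iic j).image (Tuple.sort α) ⊆ Finset.univ.filter fun i => α i ≤ t := by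
    intro l hl
    obtain ⟨l', hl', rfl⟩ := Finset.mem_image.1 hl
    have := Tuple.monotone_sort α (Finset.mem_Iic.1 hl')
    simp only [Function.comp, hj, Equiv.apply_symm_apply] at this
    simpa using this.trans hi
  have := Finset.card_le_card hsub
  rw [Finset.card_image_of_injective _ (Tuple.sort α).injective, Fin.card_Iic] at this
  exact_mod_cast this

/-- Quantising a weight `a ∈ [0, 1]` by the trapezoidal rule for the thresholds `k ε₂`. -/
lemma abs_sub_trapezoid_le {ε₂ a : ℝ} (hε : 0 < ε₂) {K : ℕ} (hK : 1 / ε₂ = K)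
    (h0 : 0 ≤ a) (h1 : a ≤ 1) :
    |a - ∑ k ∈ Finset.range K, (ε₂ - if k = 0 then ε₂ / 2 else 0) * (if a ≤ k * ε₂ then 0 else 1)|
      ≤ ε₂ / 2 := by
  have hKε : (K : ℝ) * ε₂ = 1 := by rw [← hK]; field_simp
  rcases h0.eq_or_lt with rfl | hpos
  · rw [Finset.sum_eq_zero]
    · simpa using by positivity
    · intro k _
      have : (0 : ℝ) ≤ k * ε₂ := by positivity
      simp [this]
  have hKpos : 0 < K := by
    rcases Nat.eq_zero_or_pos K with rfl | h
    · simp at hKε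
    · exact h
  set c := ⌈a / ε₂⌉₊ with hc
  have hcpos : 0 < c := Nat.ceil_pos.2 (by positivity)
  have hcK : c ≤ K := by
    rw [hc, Nat.ceil_le, ← hK]
    gcongr
  have hlt : ∀ k : ℕ, ¬ a ≤ k * ε₂ ↔ k < c := by
    intro k
    rw [hc, Nat.lt_ceil, lt_div_iff₀ hε, not_le]
  have hsum : ∑ k ∈ Finset.range K, (ε₂ - if k = 0 then ε₂ / 2 else 0) *
      (if a ≤ k * ε₂ then (0 : ℝ) else 1) = c * ε₂ - ε₂ / 2 := by
    have h1 : ∀ k ∈ Finset.range K, (ε₂ - if k = 0 then ε₂ / 2 else 0) *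
        (if a ≤ k * ε₂ then (0 : ℝ) else 1)
        = if k ∈ Finset.range c then (ε₂ - if k = 0 then ε₂ / 2 else 0) else 0 := by
      intro k _
      by_cases h : k < c
      · have h' := (hlt k).2 h
        rw [if_neg h', if_pos (Finset.mem_range.2 h), mul_one]
      · have h' := not_not.1 (mt (hlt k).1 h)
        rw [if_pos h', if_neg (fun hh => h (Finset.mem_range.1 hh)), mul_zero]
    rw [Finset.sum_congr rfl h1, ← Finset.sum_filter]
    have h2 : (Finset.range K).filter (fun k => k ∈ Finset.range c) = Finset.range c := by
      ext k; simp only [Finset.mem_filter, Finset.mem_range]; omega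
    rw [h2, Finset.sum_sub_distrib]
    simp [hcpos]
  rw [hsum]
  have h2 : a ≤ c * ε₂ := by rw [← div_le_iff₀ hε]; exact Nat.le_ceil _
  have h3 : (c : ℝ) * ε₂ < a + ε₂ := by
    have := Nat.ceil_lt_add_one (a := a / ε₂) (by positivity)
    rw [← hc] at this
    calc (c : ℝ) * ε₂ < (a / ε₂ + 1) * ε₂ := by gcongr
      _ = a + ε₂ := by field_simp
  rw [abs_le]; constructor <;> linarith

open Classical in
/-- If no erasure threshold `k ε₂` brings the received word within the decoding radius, then the
soft agreement `α · x` is small. -/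
lemma exists_erasedWord_within_radius {q N : ℕ} {r ε₁ ε₂ : ℝ} (hε : 0 < ε₂) {K : ℕ}
    (hK : 1 / ε₂ = K) (α : Fin N → ℝ) (h0 : ∀ i, 0 ≤ α i) (h1 : ∀ i, α i ≤ 1)
    (xhat x : Fin N → Fin q)
    (h : N * (ε₂ / 2 + (r + ε₁) * (1 - ε₂ / 2)) < gmdDot α xhat x) :
    ∃ k : ℕ, (k : ℝ) < 1 / ε₂ ∧
      2 * ((Finset.univ.filter fun i => erasedWord r ε₁ ε₂ k xhat α i ≠ none ∧
        erasedWord r ε₁ ε₂ k xhat α i ≠ some (x i)).card : ℝ)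
      + ((Finset.univ.filter fun i => erasedWord r ε₁ ε₂ k xhat α i = none).card : ℝ)
        < N * (1 - r - ε₁) := by
  by_contra! hcon
  set s : Fin N → ℝ := fun i => if x i = xhat i then 1 else -1 with hs
  have hs1 : ∀ i, s i ≤ 1 := fun i => by simp only [hs]; split_ifs <;> norm_num
  have hsabs : ∀ i, |s i| = 1 := fun i => by simp only [hs]; split_ifs <;> norm_num
  have hKε : (K : ℝ) * ε₂ = 1 := by rw [← hK]; field_simp
  have hF : ∀ k ∈ Finset.range K,
      ∑ i, (if α i ≤ k * ε₂ then 0 else s i) ≤ N * (r + ε₁) := by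
    intro k hk
    have hk' : (k : ℝ) < 1 / ε₂ := by rw [hK]; exact_mod_cast Finset.mem_range.1 hk
    have hN : (N : ℝ) = ∑ i : Fin N, (1 : ℝ) := by simp
    rcases le_or_gt ((Finset.univ.filter fun i => α i ≤ k * ε₂).card : ℝ) (N * (1 - r - ε₁))
      with hc | hc
    · have hfail := hcon k hk'
      have he : ∀ i, erasedWord r ε₁ ε₂ k xhat α i =
          if α i ≤ k * ε₂ then none else some (xhat i) := by
        intro i
        unfold erasedWord
        by_cases hi : α i ≤ k * ε₂
        · rw [if_pos ⟨hi, rank_le_of_card_le α hc hi⟩, if_pos hi]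
        · rw [if_neg (fun h => hi h.1), if_neg hi]
      simp only [he, Finset.card_filter] at hfail
      push_cast at hfail
      rw [Finset.mul_sum, ← Finset.sum_add_distrib] at hfail
      have key : ∑ i, (if α i ≤ k * ε₂ then 0 else s i) + ∑ i, (2 * (if ((if α i ≤ k * ε₂
          then none else some (xhat i)) ≠ none ∧ (if α i ≤ k * ε₂ then none else some (xhat i))
          ≠ some (x i)) then (1 : ℝ) else 0) + if (if α i ≤ k * ε₂ then none else some (xhat i))
          = none then (1 : ℝ) else 0) = N := by
        rw [← Finset.sum_add_distrib, hN]
        refine Finset.sum_congr rfl fun i _ => ?_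
        by_cases hi : α i ≤ k * ε₂
        · simp [hi]
        · by_cases hx : x i = xhat i
          · simp [hi, hs, hx]
          · have hx' : xhat i ≠ x i := fun h => hx h.symm
            simp [hi, hs, hx, hx']; norm_num
      linarith
    · have : ∑ i, (if α i ≤ k * ε₂ then 0 else s i) + (Finset.univ.filter fun i => α i ≤ k * ε₂).card
          ≤ N := by
        rw [Finset.card_filter]
        push_cast
        rw [← Finset.sum_add_distrib]
        conv_rhs => rw [hN]
        refine Finset.sum_le_sum fun i _ => ?_
        by_cases hi : α i ≤ k * ε₂ <;> simp [hi, hs1 i]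
      linarith
  have hw : ∀ k ∈ Finset.range K, 0 ≤ (ε₂ - if k = 0 then ε₂ / 2 else 0) := by
    intro k _; split_ifs <;> linarith
  have hKpos : 0 < K := by
    rcases Nat.eq_zero_or_pos K with rfl | h
    · simp at hKε
    · exact h
  have hwsum : ∑ k ∈ Finset.range K, (ε₂ - if k = 0 then ε₂ / 2 else 0) = 1 - ε₂ / 2 := by
    rw [Finset.sum_sub_distrib]; simp [hKpos, hKε]
  have hdot : gmdDot α xhat x ≤ ∑ i : Fin N, (ε₂ / 2 + ∑ k ∈ Finset.range K,
      (ε₂ - if k = 0 then ε₂ / 2 else 0) * (if α i ≤ k * ε₂ then 0 else s i)) := by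
    unfold gmdDot
    refine Finset.sum_le_sum fun i _ => ?_
    have h2 := abs_sub_trapezoid_le hε hK (h0 i) (h1 i)
    set A := ∑ k ∈ Finset.range K, (ε₂ - if k = 0 then ε₂ / 2 else 0) *
      (if α i ≤ k * ε₂ then (0 : ℝ) else 1) with hA
    have h3 : ∑ k ∈ Finset.range K, (ε₂ - if k = 0 then ε₂ / 2 else 0) *
        (if α i ≤ k * ε₂ then (0 : ℝ) else s i) = A * s i := by
      rw [hA, Finset.sum_mul]
      refine Finset.sum_congr rfl fun k _ => ?_
      split_ifs <;> ring
    rw [h3]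
    have h4 : (α i - A) * s i ≤ ε₂ / 2 := by
      refine (le_abs_self _).trans ?_
      rw [abs_mul, hsabs, mul_one]; exact h2
    change α i * s i ≤ _
    linarith
  rw [Finset.sum_add_distrib, Finset.sum_comm] at hdot
  simp_rw [← Finset.mul_sum] at hdot
  have h5 : ∑ k ∈ Finset.range K, (ε₂ - if k = 0 then ε₂ / 2 else 0) *
      ∑ i, (if α i ≤ k * ε₂ then (0 : ℝ) else s i) ≤ (1 - ε₂ / 2) * (N * (r + ε₁)) := by
    rw [← hwsum, Finset.sum_mul]
    exact Finset.sum_le_sum fun k hk => mul_le_mul_of_nonneg_left (hF k hk) (hw k hk)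
  simp only [Finset.sum_const, Finset.card_univ, Fintype.card_fin, nsmul_eq_mul] at hdot
  linarith

open Classical in
/-- The minimum distance of an outer code that corrects `d` erasures whenever
`d < N (1 - r - ε)`. -/
lemma NearMDSCode.le_card_ne {q N : ℕ} {r ε : ℝ} (C : NearMDSCode q N r ε) {c c' : C.code}
    (hne : c ≠ c') :
    (N : ℝ) * (1 - r - ε) ≤ (Finset.univ.filter fun i => c.1 i ≠ c'.1 i).card := by
  by_contra! hlt
  set v : Fin N → Option (Fin q) := fun i => if c.1 i ≠ c'.1 i then none else some (c.1 i) with hv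
  have hnone : ∀ i, v i = none ↔ c.1 i ≠ c'.1 i := fun i => by
    simp only [hv]; split_ifs with h <;> simp [h]
  have h1 := C.corrects c v
  have h2 := C.corrects c' v
  have e1 : (Finset.univ.filter fun i => v i ≠ none ∧ v i ≠ some (c.1 i)) = ∅ := by
    refine Finset.filter_eq_empty_iff.2 fun i _ => ?_
    simp only [hv]; split_ifs with h <;> simp
  have e2 : (Finset.univ.filter fun i => v i ≠ none ∧ v i ≠ some (c'.1 i)) = ∅ := by
    refine Finset.filter_eq_empty_iff.2 fun i _ => ?_
    simp only [hv]; split_ifs with h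
    · simp
    · simp only [ne_eq, not_not] at h; simp [h]
  have e3 : (Finset.univ.filter fun i => v i = none)
      = Finset.univ.filter fun i => c.1 i ≠ c'.1 i := by
    ext i; simp [hnone]
  rw [e1, e3] at h1
  rw [e2, e3] at h2
  have := (h1 (by simpa using hlt)).symm.trans (h2 (by simpa using hlt))
  exact hne (Option.some_injective _ this)

open Classical in
lemma gmdDot_add_gmdDot_le {q N : ℕ} (α : Fin N → ℝ) (h0 : ∀ i, 0 ≤ α i) (h1 : ∀ i, α i ≤ 1)
    (xhat x x' : Fin N → Fin q) :
    gmdDot α xhat x + gmdDot α xhat x'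
      ≤ 2 * (N - (Finset.univ.filter fun i => x i ≠ x' i).card) := by
  have hN : (N : ℝ) = ∑ i : Fin N, (1 : ℝ) := by simp
  unfold gmdDot
  rw [Finset.card_filter, hN, ← Finset.sum_add_distrib]
  push_cast
  rw [← Finset.sum_sub_distrib, Finset.mul_sum]
  refine Finset.sum_le_sum fun i _ => ?_
  have := h0 i
  have := h1 i
  by_cases hx : x i = xhat i
  · by_cases hx' : x' i = xhat i
    · simp [hx, hx']; linarith
    · have : xhat i ≠ x' i := fun h => hx' h.symm
      simp [hx, hx', this]
  · by_cases hx' : x' i = xhat i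
    · simp [hx, hx']
    · simp only [hx, hx', if_false]
      split_ifs <;> norm_num <;> linarith

open Classical in
lemma gmdDot_le_card {q N : ℕ} (α : Fin N → ℝ) (h0 : ∀ i, 0 ≤ α i) (h1 : ∀ i, α i ≤ 1)
    (xhat x : Fin N → Fin q) : gmdDot α xhat x ≤ N := by
  have := gmdDot_add_gmdDot_le α h0 h1 xhat x x
  simp at this
  linarith

/-- The revised GMD decoder outputs the transmitted codeword `x` whenever `α · x` exceeds the
threshold: some errors-and-erasures decoding finds `x`, and the minimum distance makes `x` the
strict maximiser of the soft agreement. -/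
lemma IsRevisedGMD.eq_some {q N : ℕ} {r ε₁ ε₂ : ℝ} {C : NearMDSCode q N r ε₁}
    {g : (Fin N → Fin q) → (Fin N → ℝ) → Option C.code} (hg : IsRevisedGMD C ε₂ g)
    (hε : 0 < ε₂) {K : ℕ} (hK : 1 / ε₂ = K) {α : Fin N → ℝ} (h0 : ∀ i, 0 ≤ α i)
    (h1 : ∀ i, α i ≤ 1) {xhat : Fin N → Fin q} {x : C.code}
    (h : N * (ε₂ / 2 + (r + ε₁) * (1 - ε₂ / 2)) < gmdDot α xhat x.1) :
    g xhat α = some x := by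
  obtain ⟨k, hk, hrad⟩ := exists_erasedWord_within_radius hε hK α h0 h1 xhat x.1 h
  have hdec := C.corrects x _ hrad
  obtain ⟨hnone, hsome⟩ := hg xhat α
  cases hgx : g xhat α with
  | none => simpa [hdec] using hnone hgx k hk
  | some c =>
    by_contra hne
    have hcx : x ≠ c := fun h => hne (by rw [h])
    have hmax := (hsome c hgx).2 k x hk hdec
    have hsum := gmdDot_add_gmdDot_le α h0 h1 xhat x.1 c.1
    have hdist := C.le_card_ne hcx
    have hle := gmdDot_le_card α h0 h1 xhat x.1
    have hKε : (K : ℝ) * ε₂ = 1 := by rw [← hK]; field_simp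
    have hK1 : (1 : ℝ) ≤ K := by
      rcases Nat.eq_zero_or_pos K with rfl | h
      · simp at hKε
      · exact_mod_cast h
    have hε1 : ε₂ ≤ 1 := by nlinarith
    have hN : (0 : ℝ) ≤ N := Nat.cast_nonneg _
    have h2 : (0 : ℝ) ≤ N * (1 - (r + ε₁)) := by
      by_contra! hneg
      nlinarith
    nlinarith

noncomputable section

/-! ### Trimmed sums -/

/-- The sum of `p` over `I`, with the at most `j` elements of `I` removed that make it smallest. -/
def trimmedSum {ι : Type*} [DecidableEq ι] (p : ι → ℝ) (j : ℕ) (I : Finset ι) : ℝ :=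
  (I.powerset.filter fun J => J.card ≤ j).inf' ⟨∅, by simp⟩ fun J => ∑ b ∈ I \ J, p b

section trimmedSum
variable {ι : Type*} [DecidableEq ι] {p : ι → ℝ}

lemma trimmedSum_le_sum_sdiff {j : ℕ} {I J : Finset ι} (hJ : J.card ≤ j) :
    trimmedSum p j I ≤ ∑ b ∈ I \ J, p b := by
  have h : I \ J = I \ (J ∩ I) := by ext; simp
  rw [h]
  refine Finset.inf'_le _ ?_
  simp only [Finset.mem_filter, Finset.mem_powerset]
  exact ⟨Finset.inter_subset_right, (Finset.card_le_card Finset.inter_subset_left).trans hJ⟩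

lemma exists_trimmedSum_eq (p : ι → ℝ) (j : ℕ) (I : Finset ι) :
    ∃ J ⊆ I, J.card ≤ j ∧ trimmedSum p j I = ∑ b ∈ I \ J, p b := by
  obtain ⟨J, hJ, h⟩ := Finset.exists_mem_eq_inf' (s := I.powerset.filter fun J => J.card ≤ j)
    ⟨∅, by simp⟩ (fun J => ∑ b ∈ I \ J, p b)
  simp only [Finset.mem_filter, Finset.mem_powerset] at hJ
  exact ⟨J, hJ.1, hJ.2, h⟩

lemma trimmedSum_zero (I : Finset ι) : trimmedSum p 0 I = ∑ b ∈ I, p b := by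
  obtain ⟨J, -, hJ, h⟩ := exists_trimmedSum_eq p 0 I
  rw [h, Finset.card_eq_zero.1 (Nat.le_zero.1 hJ), Finset.sdiff_empty]

lemma trimmedSum_le_sum (j : ℕ) (I : Finset ι) : trimmedSum p j I ≤ ∑ b ∈ I, p b := by
  simpa using trimmedSum_le_sum_sdiff (p := p) (j := j) (I := I) (J := ∅) (by simp)

lemma antitone_trimmedSum (I : Finset ι) : Antitone fun j => trimmedSum p j I := by
  intro j k hjk
  obtain ⟨J, -, hJ, h⟩ := exists_trimmedSum_eq p j I
  simp only
  rw [h]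
  exact trimmedSum_le_sum_sdiff (hJ.trans hjk)

lemma trimmedSum_nonneg (hp : ∀ i, 0 ≤ p i) (j : ℕ) (I : Finset ι) : 0 ≤ trimmedSum p j I := by
  obtain ⟨J, -, -, h⟩ := exists_trimmedSum_eq p j I
  rw [h]
  exact Finset.sum_nonneg fun b _ => hp b

/-- An optimal trimming of `I` either keeps the element `m`, or spends one of its removals
on it. -/
lemma min_trimmedSum_erase_le (j : ℕ) {I : Finset ι} {m : ι} (hm : m ∈ I) :
    min (trimmedSum p (j + 1) (I.erase m) + p m) (trimmedSum p j (I.erase m))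
      ≤ trimmedSum p (j + 1) I := by
  obtain ⟨J, hJI, hJ, h⟩ := exists_trimmedSum_eq p (j + 1) I
  rw [h]
  by_cases hmJ : m ∈ J
  · refine (min_le_right _ _).trans ?_
    have h1 : I \ J = (I.erase m) \ (J.erase m) := by
      ext b; simp only [Finset.mem_sdiff, Finset.mem_erase]
      constructor
      · rintro ⟨hb, hbJ⟩
        exact ⟨⟨fun e => hbJ (e ▸ hmJ), hb⟩, fun e => hbJ e.2⟩
      · rintro ⟨⟨hbm, hb⟩, hbJ⟩
        exact ⟨hb, fun e => hbJ ⟨hbm, e⟩⟩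
    rw [h1]
    refine trimmedSum_le_sum_sdiff ?_
    rw [Finset.card_erase_of_mem hmJ]; omega
  · refine (min_le_left _ _).trans ?_
    have h1 : I \ J = insert m ((I.erase m) \ J) := by
      ext b; simp only [Finset.mem_sdiff, Finset.mem_erase, Finset.mem_insert]
      constructor
      · rintro ⟨hb, hbJ⟩
        by_cases hbm : b = m
        · exact Or.inl hbm
        · exact Or.inr ⟨⟨hbm, hb⟩, hbJ⟩
      · rintro (rfl | ⟨⟨hbm, hb⟩, hbJ⟩)
        · exact ⟨hm, hmJ⟩
        · exact ⟨hb, hbJ⟩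
    rw [h1, Finset.sum_insert (by simp), add_comm]
    gcongr
    exact trimmedSum_le_sum_sdiff hJ

lemma Measurable.trimmedSum {Ω : Type*} [MeasurableSpace Ω] {p : ι → Ω → ℝ}
    (hp : ∀ i, Measurable (p i)) (j : ℕ) (I : Finset ι) :
    Measurable fun y => trimmedSum (fun i => p i y) j I := by
  have key : ∀ (s : Finset (Finset ι)) (hs : s.Nonempty),
      Measurable fun y => s.inf' hs fun J => ∑ b ∈ I \ J, p b y := by
    intro s hs
    induction hs using Finset.Nonempty.cons_induction with
    | singleton J => simpa using Finset.measurable_sum _ fun b _ => hp b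
    | cons J s hJ hs ih =>
      simp only [Finset.inf'_cons hs]
      exact (Finset.measurable_sum _ fun b _ => hp b).inf ih
  exact key _ _

end trimmedSum

/-! ### The confusion potential -/

/-- The likelihood of one word and the sum `S` of the competing likelihoods determine how much
probability is at stake: `min (x, √(x S))`. -/
def confusion (x S : ℝ) : ℝ := min x (√(x * S))

lemma confusion_nonneg {x S : ℝ} (hx : 0 ≤ x) : 0 ≤ confusion x S :=
  le_min hx (Real.sqrt_nonneg _)

lemma monotone_confusion {x : ℝ} (hx : 0 ≤ x) : Monotone (confusion x) := fun _ _ h =>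
  min_le_min le_rfl (Real.sqrt_le_sqrt (mul_le_mul_of_nonneg_left h hx))

lemma sqrt_sum_le {ι : Type*} {f : ι → ℝ} (I : Finset ι) (hf : ∀ b, 0 ≤ f b) :
    √(∑ b ∈ I, f b) ≤ ∑ b ∈ I, √(f b) := by
  refine (Real.sqrt_le_left (Finset.sum_nonneg fun b _ => Real.sqrt_nonneg _)).2 ?_
  calc ∑ b ∈ I, f b = ∑ b ∈ I, √(f b) ^ 2 :=
        Finset.sum_congr rfl fun b _ => (Real.sq_sqrt (hf b)).symm
    _ ≤ (∑ b ∈ I, √(f b)) ^ 2 := Finset.sum_sq_le_sq_sum_of_nonneg fun b _ => Real.sqrt_nonneg _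

/-- The increase of the confusion of the decided word `a`, with likelihood `x`, when the transmitted
word with likelihood `z` joins its competitors controls the moment after a wrong decision. -/
lemma half_mul_sqrt_div_le_confusion_sub {x τ z : ℝ} (hτ : 0 ≤ τ) (hz : 0 < z)
    (hx : τ + z ≤ x) :
    z * √(x / (τ + z)) ≤ 2 * (confusion x (τ + z) - confusion x τ) := by
  have hx0 : 0 < x := by linarith
  have hle : ∀ S, 0 ≤ S → S ≤ x → confusion x S = √x * √S := fun S hS hSx => by
    rw [confusion, ← Real.sqrt_mul hx0.le, min_eq_right]
    exact (Real.sqrt_le_left hx0.le).2 (by nlinarith)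
  rw [hle _ (by linarith) hx, hle _ hτ (by linarith), Real.sqrt_div hx0.le]
  set s := √(τ + z) with hs
  set t := √τ with ht
  have hs0 : 0 < s := Real.sqrt_pos.2 (by linarith)
  have ht0 : 0 ≤ t := Real.sqrt_nonneg _
  have hs2 : s ^ 2 = τ + z := Real.sq_sqrt (by linarith)
  have ht2 : t ^ 2 = τ := Real.sq_sqrt hτ
  have hz2 : z = (s - t) * (s + t) := by nlinarith
  have hts : t ≤ s := Real.sqrt_le_sqrt (by linarith)
  have hX := Real.sqrt_nonneg x
  rw [mul_div_assoc', div_le_iff₀ hs0]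
  have : z ≤ 2 * (s - t) * s := by nlinarith
  nlinarith

/-- The telescoping behind the potential: a sequence that dominates a shift-or-translate of an
antitone sequence `τ` gains at least one full translate of the last term. -/
lemma sum_add_le_sum_of_min_le {F : ℝ → ℝ} (hF : Monotone F) {σ τ : ℕ → ℝ} {z : ℝ} (hz : 0 ≤ z)
    (hτ : Antitone τ) (h0 : τ 0 + z ≤ σ 0) (h : ∀ j, min (τ (j + 1) + z) (τ j) ≤ σ (j + 1))
    (i : ℕ) :
    ∑ j ∈ Finset.range (i + 1), F (τ j) + (F (τ i + z) - F (τ i))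
      ≤ ∑ j ∈ Finset.range (i + 1), F (σ j) := by
  induction i with
  | zero => simpa using hF h0
  | succ i ih =>
    rw [Finset.sum_range_succ _ (i + 1), Finset.sum_range_succ _ (i + 1)]
    have h1 : F (τ i) ≤ F (τ i + z) := hF (by linarith)
    rcases min_le_iff.1 (h i) with h2 | h2
    · linarith [hF h2]
    · have h3 := hF h2
      have h4 : F (τ (i + 1) + z) ≤ F (τ i + z) := hF (by linarith [hτ (Nat.le_succ i)])
      linarith

section potential
variable {ι : Type*} [DecidableEq ι]

/-- The total confusion of the code `C`, summed over the trimming orders `j ≤ i`.  The removal of a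
word can lower the trimmed sum of order `j + 1` by less than its likelihood, but then the trimmed
sum is at least the old one of order `j`; the summation over `j` makes these losses telescope. -/
def potential (p : ι → ℝ) (i : ℕ) (C : Finset ι) : ℝ :=
  ∑ a ∈ C, ∑ j ∈ Finset.range (i + 1), confusion (p a) (trimmedSum p j (C.erase a))

/-- A lower bound for the decrease of the potential when the word `m` is removed from `C`. -/
def marginal (p : ι → ℝ) (i : ℕ) (C : Finset ι) (m : ι) : ℝ :=
  confusion (p m) (∑ b ∈ C.erase m, p b) +
    ∑ a ∈ C.erase m, (confusion (p a) (trimmedSum p i ((C.erase a).erase m) + p m)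
      - confusion (p a) (trimmedSum p i ((C.erase a).erase m)))

variable {p : ι → ℝ}

lemma potential_nonneg (hp : ∀ b, 0 ≤ p b) (i : ℕ) (C : Finset ι) : 0 ≤ potential p i C :=
  Finset.sum_nonneg fun a _ => Finset.sum_nonneg fun _ _ => confusion_nonneg (hp a)

lemma confusion_sub_nonneg (hp : ∀ b, 0 ≤ p b) (i : ℕ) (I : Finset ι) (a m : ι) :
    0 ≤ confusion (p a) (trimmedSum p i I + p m) - confusion (p a) (trimmedSum p i I) :=
  sub_nonneg.2 (monotone_confusion (hp a) (by linarith [hp m]))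

lemma marginal_nonneg (hp : ∀ b, 0 ≤ p b) (i : ℕ) (C : Finset ι) (m : ι) :
    0 ≤ marginal p i C m :=
  add_nonneg (confusion_nonneg (hp m))
    (Finset.sum_nonneg fun a _ => confusion_sub_nonneg hp i _ a m)

lemma potential_erase_add_marginal_le (hp : ∀ b, 0 ≤ p b) (i : ℕ) {C : Finset ι} {m : ι}
    (hm : m ∈ C) : potential p i (C.erase m) + marginal p i C m ≤ potential p i C := by
  unfold potential marginal
  rw [← Finset.add_sum_erase C _ hm]
  have h1 : confusion (p m) (∑ b ∈ C.erase m, p b)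
      ≤ ∑ j ∈ Finset.range (i + 1), confusion (p m) (trimmedSum p j (C.erase m)) := by
    rw [← trimmedSum_zero]
    exact Finset.single_le_sum (f := fun j => confusion (p m) (trimmedSum p j (C.erase m)))
      (fun j _ => confusion_nonneg (hp m)) (Finset.mem_range.2 (Nat.succ_pos i))
  have h2 : ∀ a ∈ C.erase m,
      ∑ j ∈ Finset.range (i + 1), confusion (p a) (trimmedSum p j ((C.erase m).erase a)) +
      (confusion (p a) (trimmedSum p i ((C.erase a).erase m) + p m)
      - confusion (p a) (trimmedSum p i ((C.erase a).erase m)))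
      ≤ ∑ j ∈ Finset.range (i + 1), confusion (p a) (trimmedSum p j (C.erase a)) := by
    intro a ha
    have hma : m ∈ C.erase a := Finset.mem_erase.2 ⟨(Finset.ne_of_mem_erase ha).symm, hm⟩
    rw [Finset.erase_right_comm]
    refine sum_add_le_sum_of_min_le (monotone_confusion (hp a))
      (τ := fun j => trimmedSum p j ((C.erase a).erase m))
      (σ := fun j => trimmedSum p j (C.erase a)) (hp m) (antitone_trimmedSum _) ?_
      (fun j => min_trimmedSum_erase_le j hma) i
    simp only [trimmedSum_zero]
    rw [← Finset.add_sum_erase _ _ hma, add_comm]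
  have h3 := Finset.sum_le_sum h2
  rw [Finset.sum_add_distrib] at h3
  linarith

lemma potential_le (hp : ∀ b, 0 ≤ p b) (i : ℕ) (C : Finset ι) :
    potential p i C ≤ (i + 1) * ∑ a ∈ C, confusion (p a) (∑ b ∈ C.erase a, p b) := by
  unfold potential
  rw [Finset.mul_sum]
  refine Finset.sum_le_sum fun a _ => ?_
  calc _ ≤ ∑ j ∈ Finset.range (i + 1), confusion (p a) (∑ b ∈ C.erase a, p b) :=
        Finset.sum_le_sum fun j _ => monotone_confusion (hp a) (trimmedSum_le_sum _ _)
    _ = _ := by simp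

end potential

/-! ### The exponential moment of one inner decision -/

section trust
variable {ι : Type*} [DecidableEq ι]

/-- Forney's reliability weight of the decision for `a` among the words of `C`, as a function of
the likelihoods. -/
def trust (p : ι → ℝ) (C : Finset ι) (T : ℝ) (a : ι) : ℝ :=
  if ∑ b ∈ C.erase a, p b = 0 then 1
  else max 0 (min 1 (Real.log (p a / ∑ b ∈ C.erase a, p b) / (2 * T)))

variable {p : ι → ℝ} {C : Finset ι} {T : ℝ} {a m : ι}

lemma exp_mul_log_div_eq_sqrt {x : ℝ} (hT : 0 < T) (hx : 0 < x) :
    Real.exp (T * (Real.log x / (2 * T))) = √x := by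
  rw [show T * (Real.log x / (2 * T)) = Real.log x / 2 by field_simp, Real.exp_half,
    Real.exp_log hx]

/-- The moment after a correct decision. -/
lemma mul_exp_neg_trust_le (hp : ∀ b, 0 ≤ p b) (hT : 0 < T) (m : ι) :
    p m * Real.exp (-(T * trust p C T m))
      ≤ p m * Real.exp (-T) + confusion (p m) (∑ b ∈ C.erase m, p b) := by
  rcases (hp m).eq_or_lt with h0 | h0
  · rw [← h0]; simp [confusion]
  set S := ∑ b ∈ C.erase m, p b with hS
  have hS0 : 0 ≤ S := Finset.sum_nonneg fun b _ => hp b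
  unfold trust
  rw [← hS]
  split_ifs with h
  · rw [mul_one]
    linarith [confusion_nonneg (S := S) h0.le]
  have hSpos : 0 < S := lt_of_le_of_ne hS0 (Ne.symm h)
  set l := Real.log (p m / S) / (2 * T) with hl
  have hexp : Real.exp (T * l) = √(p m / S) := exp_mul_log_div_eq_sqrt hT (by positivity)
  have hpm : p m * Real.exp (-(T * l)) = √(p m * S) := by
    rw [Real.exp_neg, hexp, ← div_eq_mul_inv, div_eq_iff (by positivity),
      ← Real.sqrt_mul (by positivity), show p m * S * (p m / S) = p m * p m by field_simp,
      Real.sqrt_mul_self h0.le]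
  rcases le_total l 0 with hl0 | hl0
  · rw [max_eq_left ((min_le_right _ _).trans hl0), mul_zero, neg_zero, Real.exp_zero, mul_one,
      confusion, min_eq_left]
    · have := mul_pos h0 (Real.exp_pos (-T)); linarith
    · rw [← hpm]
      have : 1 ≤ Real.exp (-(T * l)) := Real.one_le_exp (by nlinarith)
      nlinarith
  rcases le_total 1 l with hl1 | hl1
  · rw [min_eq_left hl1, max_eq_right zero_le_one, mul_one]
    linarith [confusion_nonneg (S := S) h0.le]
  · rw [min_eq_right hl1, max_eq_right hl0, confusion, min_eq_right, hpm]
    · have := mul_pos h0 (Real.exp_pos (-T)); linarith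
    · rw [← hpm]
      have : Real.exp (-(T * l)) ≤ 1 := Real.exp_le_one_iff.2 (by nlinarith)
      nlinarith

lemma confusion_eq_left_of_le {x S : ℝ} (hx : 0 ≤ x) (h : x ≤ S) : confusion x S = x :=
  min_eq_left (Real.le_sqrt_of_sq_le (by nlinarith))

/-- The moment after a wrong decision for `a`.  The first term covers the unreliable decisions, the
second one is the part that need not decrease when words are deleted. -/
lemma mul_exp_trust_le (hp : ∀ b, 0 ≤ p b) (hT : 0 < T) (ha : a ∈ C) (hm : m ∈ C) (hma : m ≠ a)
    (htop : p m ≤ p a) :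
    p m * Real.exp (T * trust p C T a)
      ≤ confusion (p m) (∑ b ∈ C.erase m, p b)
        + p m * min (Real.exp T) (√(p a / ∑ b ∈ C.erase a, p b)) := by
  rcases (hp m).eq_or_lt with h0 | h0
  · rw [← h0]; simp [confusion]
  have hSm : p a ≤ ∑ b ∈ C.erase m, p b :=
    Finset.single_le_sum (fun b _ => hp b) (Finset.mem_erase.2 ⟨hma.symm, ha⟩)
  have hSa : p m ≤ ∑ b ∈ C.erase a, p b :=
    Finset.single_le_sum (fun b _ => hp b) (Finset.mem_erase.2 ⟨hma, hm⟩)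
  rw [confusion_eq_left_of_le h0.le (htop.trans hSm)]
  set S := ∑ b ∈ C.erase a, p b with hS
  have hSpos : 0 < S := by linarith
  have ha0 : 0 < p a := by linarith
  unfold trust
  rw [← hS, if_neg hSpos.ne']
  set l := Real.log (p a / S) / (2 * T) with hl
  have hexp : Real.exp (T * l) = √(p a / S) := exp_mul_log_div_eq_sqrt hT (by positivity)
  have key : Real.exp (T * max 0 (min 1 l)) ≤ 1 + min (Real.exp T) (√(p a / S)) := by
    have hmin : 0 ≤ min (Real.exp T) (√(p a / S)) := le_min (Real.exp_pos _).le (Real.sqrt_nonneg _)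
    rcases le_total (min 1 l) 0 with h | h
    · rw [max_eq_left h]; simp only [mul_zero, Real.exp_zero]; linarith
    · rw [max_eq_right h, ← hexp]
      have h1 : Real.exp (T * min 1 l) ≤ Real.exp T :=
        Real.exp_le_exp.2 (by nlinarith [min_le_left 1 l])
      have h2 : Real.exp (T * min 1 l) ≤ Real.exp (T * l) :=
        Real.exp_le_exp.2 (by nlinarith [min_le_right 1 l])
      linarith [le_min h1 h2]
  nlinarith

/-- The signed reliability of the decision `a` when `m` was sent. -/
def signedTrust (p : ι → ℝ) (C : Finset ι) (T : ℝ) (a m : ι) : ℝ :=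
  trust p C T a * (if m = a then 1 else -1)

/-- Pairwise bound for the moment, in terms of the Bhattacharyya integrands. -/
lemma mul_exp_signedTrust_le_sum_sqrt (hp : ∀ b, 0 ≤ p b) (hT : 0 < T) (ha : a ∈ C) (hm : m ∈ C)
    (htop : ∀ b ∈ C, p b ≤ p a) :
    p m * Real.exp (-(T * signedTrust p C T a m))
      ≤ p m * Real.exp (-T) + 2 * ∑ b ∈ C.erase m, √(p m * p b) := by
  have hg : confusion (p m) (∑ b ∈ C.erase m, p b) ≤ ∑ b ∈ C.erase m, √(p m * p b) := by
    refine (min_le_right _ _).trans ?_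
    rw [Finset.mul_sum]
    exact sqrt_sum_le _ fun b => mul_nonneg (hp m) (hp b)
  have h0 : 0 ≤ ∑ b ∈ C.erase m, √(p m * p b) := Finset.sum_nonneg fun _ _ => Real.sqrt_nonneg _
  unfold signedTrust
  split_ifs with h
  · subst h
    rw [mul_one]
    have := mul_exp_neg_trust_le (C := C) hp hT m
    linarith
  · have h1 := mul_exp_trust_le hp hT ha hm h (htop m hm)
    have h2 : p m * min (Real.exp T) (√(p a / ∑ b ∈ C.erase a, p b)) ≤ √(p m * p a) := by
      rcases (hp m).eq_or_lt with hz | hz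
      · rw [← hz]; simp
      have hSa : p m ≤ ∑ b ∈ C.erase a, p b :=
        Finset.single_le_sum (fun b _ => hp b) (Finset.mem_erase.2 ⟨h, hm⟩)
      calc _ ≤ p m * √(p a / p m) := by
            refine mul_le_mul_of_nonneg_left ((min_le_right _ _).trans ?_) hz.le
            exact Real.sqrt_le_sqrt (div_le_div_of_nonneg_left (hp a) hz hSa)
        _ = √(p m * p a) := by
            rw [show p m * p a = p m ^ 2 * (p a / p m) by field_simp,
              Real.sqrt_mul (by positivity), Real.sqrt_sq hz.le]
    have h3 : √(p m * p a) ≤ ∑ b ∈ C.erase m, √(p m * p b) :=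
      Finset.single_le_sum (f := fun b => √(p m * p b)) (fun b _ => Real.sqrt_nonneg _)
        (Finset.mem_erase.2 ⟨fun e => h e.symm, ha⟩)
    rw [show -(T * (trust p C T a * -1)) = T * trust p C T a by ring]
    have := mul_nonneg (hp m) (Real.exp_pos (-T)).le
    linarith

/-- Bound for the moment in terms of the marginals of the potential of a larger code `C`, of which
the words in `Q` are deleted; the last sum collects the words whose competitors lose too much of
their likelihood by the deletion. -/
lemma mul_exp_signedTrust_le_marginal (hp : ∀ b, 0 ≤ p b) (hT : 0 < T) (i : ℕ) {Q : Finset ι}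
    (ha : a ∈ C \ Q) (hm : m ∈ C \ Q) (htop : ∀ b ∈ C \ Q, p b ≤ p a) :
    p m * Real.exp (-(T * signedTrust p (C \ Q) T a m))
      ≤ p m * Real.exp (-T) + 4 * marginal p i C m
        + Real.exp T * ∑ b ∈ C.erase m,
          if ∑ c ∈ ((C.erase b).erase m) \ Q, p c < trimmedSum p i ((C.erase b).erase m) / 2
          then p m else 0 := by
  have hsub : (C \ Q).erase m ⊆ C.erase m := Finset.erase_subset_erase _ Finset.sdiff_subset
  have hg : confusion (p m) (∑ b ∈ (C \ Q).erase m, p b)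
      ≤ confusion (p m) (∑ b ∈ C.erase m, p b) :=
    monotone_confusion (hp m) (Finset.sum_le_sum_of_subset_of_nonneg hsub fun b _ _ => hp b)
  have hΔ0 : 0 ≤ ∑ a ∈ C.erase m, (confusion (p a) (trimmedSum p i ((C.erase a).erase m) + p m)
      - confusion (p a) (trimmedSum p i ((C.erase a).erase m))) :=
    Finset.sum_nonneg fun a _ => confusion_sub_nonneg hp i _ a m
  have hg0 : 0 ≤ confusion (p m) (∑ b ∈ (C \ Q).erase m, p b) := confusion_nonneg (hp m)
  have hfail0 : ∀ b ∈ C.erase m, 0 ≤ (if ∑ c ∈ ((C.erase b).erase m) \ Q, p c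
      < trimmedSum p i ((C.erase b).erase m) / 2 then p m else 0) := by
    intro b _; split_ifs; exacts [hp m, le_rfl]
  have hfs := mul_nonneg (Real.exp_pos T).le (Finset.sum_nonneg hfail0)
  have he0 := mul_nonneg (hp m) (Real.exp_pos (-T)).le
  unfold signedTrust marginal
  split_ifs with h
  · subst h
    rw [mul_one]
    have := mul_exp_neg_trust_le (C := C \ Q) hp hT m
    linarith
  have h1 := mul_exp_trust_le hp hT ha hm h (htop m hm)
  rw [show -(T * (trust p (C \ Q) T a * -1)) = T * trust p (C \ Q) T a by ring]
  have hCa : a ∈ C.erase m :=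
    Finset.mem_erase.2 ⟨fun e => h e.symm, (Finset.mem_sdiff.1 ha).1⟩
  set I := (C.erase a).erase m with hI
  by_cases hfail : ∑ c ∈ I \ Q, p c < trimmedSum p i I / 2
  · have h2 : p m ≤ ∑ b ∈ C.erase m, (if ∑ c ∈ ((C.erase b).erase m) \ Q, p c
        < trimmedSum p i ((C.erase b).erase m) / 2 then p m else 0) := by
      have := Finset.single_le_sum hfail0 hCa
      rwa [if_pos hfail] at this
    have h3 : p m * min (Real.exp T) (√(p a / ∑ b ∈ (C \ Q).erase a, p b))
        ≤ Real.exp T * p m := by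
      rw [mul_comm]
      exact mul_le_mul_of_nonneg_right (min_le_left _ _) (hp m)
    have h4 := mul_le_mul_of_nonneg_left h2 (Real.exp_pos T).le
    linarith
  rw [not_lt] at hfail
  have h2 : p m * min (Real.exp T) (√(p a / ∑ b ∈ (C \ Q).erase a, p b))
      ≤ 2 * confusion (p m) (∑ b ∈ (C \ Q).erase m, p b) +
        4 * (confusion (p a) (trimmedSum p i I + p m) - confusion (p a) (trimmedSum p i I)) := by
    have hd0 := confusion_sub_nonneg hp i I a m
    rcases (hp m).eq_or_lt with hz | hz
    · rw [← hz] at hd0 ⊢; simp only [zero_mul]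
      have : 0 ≤ confusion 0 (∑ b ∈ (C \ Q).erase m, p b) := confusion_nonneg le_rfl
      linarith
    have hτ := trimmedSum_nonneg hp i I
    set τ := trimmedSum p i I with hτdef
    have hS : (τ + p m) / 2 ≤ ∑ b ∈ (C \ Q).erase a, p b := by
      have h3 : (C \ Q).erase a = insert m (I \ Q) := by
        ext b
        simp only [hI, Finset.mem_erase, Finset.mem_sdiff, Finset.mem_insert]
        constructor
        · rintro ⟨hba, hbC, hbQ⟩
          by_cases hbm : b = m
          · exact Or.inl hbm
          · exact Or.inr ⟨⟨hbm, hba, hbC⟩, hbQ⟩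
        · rintro (rfl | ⟨⟨hbm, hba, hbC⟩, hbQ⟩)
          · exact ⟨h, (Finset.mem_sdiff.1 hm)⟩
          · exact ⟨hba, hbC, hbQ⟩
      rw [h3, Finset.sum_insert (by simp [hI])]
      linarith
    have hsq : √(p a / ∑ b ∈ (C \ Q).erase a, p b) ≤ 2 * √(p a / (τ + p m)) := by
      rw [show (2 : ℝ) * √(p a / (τ + p m)) = √(4 * (p a / (τ + p m))) by
        rw [Real.sqrt_mul (by norm_num), show (4 : ℝ) = 2 ^ 2 by norm_num,
          Real.sqrt_sq (by norm_num)]]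
      refine Real.sqrt_le_sqrt ?_
      calc p a / ∑ b ∈ (C \ Q).erase a, p b ≤ p a / ((τ + p m) / 2) :=
            div_le_div_of_nonneg_left (hp a) (by positivity) hS
        _ = 2 * (p a / (τ + p m)) := by field_simp
        _ ≤ 4 * (p a / (τ + p m)) := by
            have : 0 ≤ p a / (τ + p m) := div_nonneg (hp a) (by positivity)
            linarith
    have h5 : p m * min (Real.exp T) (√(p a / ∑ b ∈ (C \ Q).erase a, p b))
        ≤ 2 * (p m * √(p a / (τ + p m))) := by
      calc _ ≤ p m * (2 * √(p a / (τ + p m))) :=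
            mul_le_mul_of_nonneg_left ((min_le_right _ _).trans hsq) hz.le
        _ = _ := by ring
    rcases le_total (τ + p m) (p a) with hc | hc
    · have := half_mul_sqrt_div_le_confusion_sub hτ hz hc
      linarith
    · have h6 : √(p a / (τ + p m)) ≤ 1 := by
        rw [Real.sqrt_le_one]
        exact div_le_one_of_le₀ hc (by positivity)
      have hSm : p a ≤ ∑ b ∈ (C \ Q).erase m, p b :=
        Finset.single_le_sum (fun b _ => hp b) (Finset.mem_erase.2 ⟨fun e => h e.symm, ha⟩)
      rw [confusion_eq_left_of_le hz.le ((htop m hm).trans hSm)]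
      nlinarith
  have h3 : confusion (p a) (trimmedSum p i I + p m) - confusion (p a) (trimmedSum p i I)
      ≤ ∑ a ∈ C.erase m, (confusion (p a) (trimmedSum p i ((C.erase a).erase m) + p m)
      - confusion (p a) (trimmedSum p i ((C.erase a).erase m))) :=
    Finset.single_le_sum (f := fun a => confusion (p a) (trimmedSum p i ((C.erase a).erase m) + p m)
      - confusion (p a) (trimmedSum p i ((C.erase a).erase m)))
      (fun a _ => confusion_sub_nonneg hp i _ a m) hCa
  linarith

end trust

end

/-! ### Deleting a random set of words -/

lemma choose_sub_le_pow_mul_choose : ∀ (b n k : ℕ), b ≤ k → k ≤ n →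
    ((n - b).choose (k - b) : ℝ) ≤ ((k : ℝ) / n) ^ b * n.choose k
  | 0, n, k, _, _ => by simp
  | b + 1, 0, k, h, h' => by omega
  | b + 1, n + 1, 0, h, h' => by omega
  | b + 1, n + 1, k + 1, h, h' => by
    have ih := choose_sub_le_pow_mul_choose b n k (by omega) (by omega)
    rw [Nat.add_sub_add_right, Nat.add_sub_add_right]
    have h1 : ((n.choose k : ℕ) : ℝ) = ((k + 1 : ℕ) : ℝ) / ((n + 1 : ℕ) : ℝ)
        * (n + 1).choose (k + 1) := by
      have := Nat.add_one_mul_choose_eq n k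
      have h2 : ((n : ℝ) + 1) * n.choose k = (n + 1).choose (k + 1) * (k + 1) := by
        exact_mod_cast this
      push_cast
      field_simp
      linarith
    have h2 : (k : ℝ) / n ≤ ((k + 1 : ℕ) : ℝ) / ((n + 1 : ℕ) : ℝ) := by
      rcases Nat.eq_zero_or_pos n with rfl | hn
      · simp; positivity
      · have hn' : (0 : ℝ) < n := by exact_mod_cast hn
        have hk : (k : ℝ) ≤ n := by exact_mod_cast (by omega : k ≤ n)
        rw [div_le_div_iff₀ hn' (by positivity)]
        push_cast
        nlinarith
    calc ((n - b).choose (k - b) : ℝ) ≤ ((k : ℝ) / n) ^ b * n.choose k := ih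
      _ ≤ (((k + 1 : ℕ) : ℝ) / ((n + 1 : ℕ) : ℝ)) ^ b * n.choose k := by gcongr
      _ = _ := by rw [h1]; ring

/-- A uniformly random `k`-element subset of `C` contains a given set `J` with probability at most
`(k / |C|) ^ |J|`. -/
lemma card_filter_subset_powersetCard_le {ι : Type*} [DecidableEq ι] {C J : Finset ι} {k : ℕ}
    (hJ : J ⊆ C) (hk : k ≤ C.card) :
    (((C.powersetCard k).filter fun Q => J ⊆ Q).card : ℝ)
      ≤ ((k : ℝ) / C.card) ^ J.card * (C.powersetCard k).card := by
  by_cases h : J.card ≤ k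
  · rw [Finset.card_filter_powersetCard_subset J C k hJ h, Finset.card_powersetCard]
    exact choose_sub_le_pow_mul_choose _ _ _ h hk
  · have : ((C.powersetCard k).filter fun Q => J ⊆ Q) = ∅ := by
      refine Finset.filter_eq_empty_iff.2 fun Q hQ hJQ => h ?_
      rw [← (Finset.mem_powersetCard.1 hQ).2]
      exact Finset.card_le_card hJQ
    rw [this]
    simp only [Finset.card_empty, Nat.cast_zero]
    positivity

/-- If a random set `Q` contains every `i`-element subset of `I` with probability at most `θ ^ i`,
then deleting `Q` brings the sum over `I` below half the trimmed sum with probability at most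
`(2 θ) ^ i`.  The bound is proved for the event that moreover `J ⊆ Q`, by downward induction on
`|J|`: when the deletion does so much harm, an element of `I \ J` chosen with probability
proportional to `p` lies in `Q` with probability at least one half. -/
lemma card_filter_sum_sdiff_lt_le {ι : Type*} [DecidableEq ι] {p : ι → ℝ} (hp : ∀ b, 0 ≤ p b)
    {I : Finset ι} (𝒬 : Finset (Finset ι)) {θ : ℝ} (hθ : 0 ≤ θ) {i : ℕ}
    (h : ∀ J ⊆ I, J.card = i → ((𝒬.filter fun Q => J ⊆ Q).card : ℝ) ≤ θ ^ i * 𝒬.card) :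
    ((𝒬.filter fun Q => ∑ c ∈ I \ Q, p c < trimmedSum p i I / 2).card : ℝ)
      ≤ (2 * θ) ^ i * 𝒬.card := by
  set τ := trimmedSum p i I with hτ
  have key : ∀ k ≤ i, ∀ J ⊆ I, J.card + k = i →
      ((𝒬.filter fun Q => J ⊆ Q ∧ ∑ c ∈ I \ Q, p c < τ / 2).card : ℝ)
        ≤ 2 ^ k * (θ ^ i * 𝒬.card) := by
    intro k
    induction k with
    | zero =>
      intro _ J hJ hJi
      rw [pow_zero, one_mul]
      refine le_trans ?_ (h J hJ (by omega))
      refine Nat.cast_le.2 (Finset.card_le_card fun Q hQ => ?_)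
      simp only [Finset.mem_filter] at hQ ⊢
      exact ⟨hQ.1, hQ.2.1⟩
    | succ k ih =>
      intro hk J hJ hJi
      set F := 𝒬.filter fun Q => J ⊆ Q ∧ ∑ c ∈ I \ Q, p c < τ / 2 with hF
      have hstep : ∀ l ∈ I \ J, ((F.filter fun Q => l ∈ Q).card : ℝ)
          ≤ 2 ^ k * (θ ^ i * 𝒬.card) := by
        intro l hl
        obtain ⟨hlI, hlJ⟩ := Finset.mem_sdiff.1 hl
        refine le_trans ?_ (ih (by omega) (insert l J)
          (Finset.insert_subset hlI hJ) (by rw [Finset.card_insert_of_notMem hlJ]; omega))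
        refine Nat.cast_le.2 (Finset.card_le_card fun Q hQ => ?_)
        simp only [hF, Finset.mem_filter] at hQ ⊢
        exact ⟨hQ.1.1, Finset.insert_subset hQ.2 hQ.1.2.1, hQ.1.2.2⟩
      rcases F.eq_empty_or_nonempty with hFe | ⟨Q₀, hQ₀⟩
      · rw [hFe, Finset.card_empty, Nat.cast_zero]; positivity
      have hpos : 0 < ∑ c ∈ I \ J, p c := by
        have h1 := (Finset.mem_filter.1 hQ₀).2.2
        have h2 : 0 ≤ ∑ c ∈ I \ Q₀, p c := Finset.sum_nonneg fun c _ => hp c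
        have h3 : τ ≤ ∑ c ∈ I \ J, p c := trimmedSum_le_sum_sdiff (by omega)
        linarith
      have hhalf : ∀ Q ∈ F, ∑ c ∈ I \ J, p c ≤ 2 * ∑ l ∈ I \ J, if l ∈ Q then p l else 0 := by
        intro Q hQ
        obtain ⟨-, hJQ, hlt⟩ := Finset.mem_filter.1 hQ
        have h3 : τ ≤ ∑ c ∈ I \ J, p c := trimmedSum_le_sum_sdiff (by omega)
        have h4 : ∑ c ∈ I \ J, p c
            = ∑ l ∈ I \ J, (if l ∈ Q then p l else 0) + ∑ l ∈ I \ J, if l ∈ Q then 0 else p l := by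
          rw [← Finset.sum_add_distrib]
          exact Finset.sum_congr rfl fun l _ => by split_ifs <;> simp
        have h5 : ∑ l ∈ I \ J, (if l ∈ Q then 0 else p l) ≤ ∑ c ∈ I \ Q, p c := by
          have : ∑ c ∈ I \ Q, p c = ∑ l ∈ I, if l ∈ Q then 0 else p l := by
            rw [Finset.sdiff_eq_filter, Finset.sum_filter]
            exact Finset.sum_congr rfl fun l _ => by split_ifs <;> simp_all
          rw [this]
          refine Finset.sum_le_sum_of_subset_of_nonneg Finset.sdiff_subset fun l _ _ => ?_
          split_ifs; exacts [le_rfl, hp l]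
        linarith
      have hsum : (F.card : ℝ) * ∑ c ∈ I \ J, p c
          ≤ (2 ^ (k + 1) * (θ ^ i * 𝒬.card)) * ∑ c ∈ I \ J, p c := by
        calc (F.card : ℝ) * ∑ c ∈ I \ J, p c = ∑ Q ∈ F, ∑ c ∈ I \ J, p c := by
              rw [Finset.sum_const, nsmul_eq_mul]
          _ ≤ ∑ Q ∈ F, 2 * ∑ l ∈ I \ J, (if l ∈ Q then p l else 0) := Finset.sum_le_sum hhalf
          _ = 2 * ∑ l ∈ I \ J, p l * (F.filter fun Q => l ∈ Q).card := by
              rw [← Finset.mul_sum, Finset.sum_comm]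
              congr 1
              refine Finset.sum_congr rfl fun l _ => ?_
              rw [← Finset.sum_filter, Finset.sum_const, nsmul_eq_mul, mul_comm]
          _ ≤ 2 * ∑ l ∈ I \ J, p l * (2 ^ k * (θ ^ i * 𝒬.card)) := by
              refine mul_le_mul_of_nonneg_left (Finset.sum_le_sum fun l hl => ?_) zero_le_two
              exact mul_le_mul_of_nonneg_left (hstep l hl) (hp l)
          _ = _ := by rw [← Finset.sum_mul]; ring
      exact le_of_mul_le_mul_right hsum hpos
  have := key i le_rfl ∅ (Finset.empty_subset _) (by simp)
  simp only [Finset.empty_subset, true_and] at this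
  rw [mul_pow, mul_assoc]
  exact this

/-! ### Selecting a subcode -/

/-- The potential method.  From a list of `M + D` likelihood functions with small total confusion
one can select `M` such that *every* word has a small exponential moment, for any
maximum-likelihood decision.  First take the set `C` of at least `M` words that minimises the
integrated potential plus a price per missing word: there the marginal of every word is at most
that price.  Then delete a uniformly random part of the superfluous words. -/
theorem exists_subcode_of_confusion {Ω : Type*} [MeasurableSpace Ω] (μ : Measure Ω) {M D : ℕ}
    (hM : 0 < M) (hD : 0 < D) {p : Fin (M + D) → Ω → ℝ} (hpm : ∀ b, Measurable (p b))
    (hp : ∀ b y, 0 ≤ p b y) (hp1 : ∀ b, ∫⁻ y, ENNReal.ofReal (p b y) ∂μ ≤ 1) {G : ℝ} (hG : 0 < G)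
    (hconf : ∑ a, ∫⁻ y, ENNReal.ofReal (confusion (p a y) (∑ b ∈ Finset.univ.erase a, p b y)) ∂μ
      ≤ ENNReal.ofReal G) (i : ℕ) :
    ∃ S : Finset (Fin (M + D)), S.card = M ∧ ∀ T : ℝ, 0 < T → ∀ m ∈ S, ∀ top : Ω → Fin (M + D),
      (∀ y, top y ∈ S ∧ ∀ b ∈ S, p b y ≤ p (top y) y) →
      ∫⁻ y, ENNReal.ofReal (p m y *
        Real.exp (-(T * signedTrust (fun b => p b y) S T (top y) m))) ∂μ
      ≤ ENNReal.ofReal (Real.exp (-T) + 4 * ((i + 1) * G / D)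
          + Real.exp T * ((M + D) ^ 2 * (2 * (D / M)) ^ i)) := by
  classical
  set Φ : Finset (Fin (M + D)) → ℝ≥0∞ := fun C =>
    ∫⁻ y, ENNReal.ofReal (potential (fun b => p b y) i C) ∂μ with hΦ
  set β : ℝ≥0∞ := ENNReal.ofReal ((i + 1) * G / D) with hβ
  have hD' : (0 : ℝ) < D := by exact_mod_cast hD
  have hM' : (0 : ℝ) < M := by exact_mod_cast hM
  have hconfm : ∀ (a : Fin (M + D)) {f : Ω → ℝ}, Measurable f →
      Measurable fun y => confusion (p a y) (f y) := fun a f hf =>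
    (hpm a).min ((hpm a).mul hf).sqrt
  have hpotm : ∀ C, Measurable fun y => potential (fun b => p b y) i C := fun C =>
    Finset.measurable_sum _ fun a _ => Finset.measurable_sum _ fun j _ =>
      hconfm a (Measurable.trimmedSum hpm j _)
  have hmargm : ∀ C m, Measurable fun y => marginal (fun b => p b y) i C m := fun C m =>
    (hconfm m (Finset.measurable_sum _ fun b _ => hpm b)).add
      (Finset.measurable_sum _ fun a _ =>
        (hconfm a ((Measurable.trimmedSum hpm i _).add (hpm m))).sub
          (hconfm a (Measurable.trimmedSum hpm i _)))
  have hΦuniv : Φ Finset.univ ≤ ENNReal.ofReal ((i + 1) * G) := by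
    calc Φ Finset.univ ≤ ∫⁻ y, ENNReal.ofReal (i + 1) * ∑ a,
          ENNReal.ofReal (confusion (p a y) (∑ b ∈ Finset.univ.erase a, p b y)) ∂μ := by
          refine lintegral_mono fun y => ?_
          rw [← ENNReal.ofReal_sum_of_nonneg fun a _ => confusion_nonneg (hp a y),
            ← ENNReal.ofReal_mul (by positivity)]
          exact ENNReal.ofReal_le_ofReal (potential_le (fun b => hp b y) i _)
      _ = ENNReal.ofReal (i + 1) * ∑ a, ∫⁻ y,
          ENNReal.ofReal (confusion (p a y) (∑ b ∈ Finset.univ.erase a, p b y)) ∂μ := by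
          have hm : ∀ a, Measurable fun y =>
              ENNReal.ofReal (confusion (p a y) (∑ b ∈ Finset.univ.erase a, p b y)) := fun a =>
            (hconfm a (Finset.measurable_sum _ fun b _ => hpm b)).ennreal_ofReal
          rw [lintegral_const_mul _ (Finset.measurable_sum _ fun a _ => hm a),
            lintegral_finsetSum _ fun a _ => hm a]
      _ ≤ ENNReal.ofReal (i + 1) * ENNReal.ofReal G := by gcongr
      _ = _ := (ENNReal.ofReal_mul (by positivity)).symm
  have hβD : β * D = ENNReal.ofReal ((i + 1) * G) := by
    rw [hβ, ← ENNReal.ofReal_natCast D, ← ENNReal.ofReal_mul (by positivity)]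
    congr 1; field_simp
  have hβ0 : β ≠ 0 := (ENNReal.ofReal_pos.2 (by positivity)).ne'
  have hβt : β ≠ ∞ := ENNReal.ofReal_ne_top
  obtain ⟨C, -, hCmin⟩ := Finset.exists_min_image (Finset.univ : Finset (Finset (Fin (M + D))))
    (fun C => Φ C + β * Cᶜ.card) Finset.univ_nonempty
  have hCuniv : Φ C + β * Cᶜ.card ≤ ENNReal.ofReal ((i + 1) * G) := by
    refine (hCmin Finset.univ (Finset.mem_univ _)).trans ?_
    simpa using hΦuniv
  have hΦC : Φ C ≠ ∞ := ((le_self_add.trans hCuniv).trans_lt ENNReal.ofReal_lt_top).ne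
  have hCcard : M ≤ C.card := by
    have h1 : β * Cᶜ.card ≤ β * D := hβD ▸ le_add_self.trans hCuniv
    have h2 : Cᶜ.card ≤ D := by
      have := (ENNReal.mul_le_mul_iff_right hβ0 hβt).1 h1
      exact_mod_cast this
    rw [Finset.card_compl, Fintype.card_fin] at h2
    omega
  have hmarg : ∀ m ∈ C, ∫⁻ y, ENNReal.ofReal (marginal (fun b => p b y) i C m) ∂μ ≤ β := by
    intro m hm
    have h1 : Φ (C.erase m) + ∫⁻ y, ENNReal.ofReal (marginal (fun b => p b y) i C m) ∂μ
        ≤ Φ C := by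
      rw [hΦ, ← lintegral_add_left (hpotm _).ennreal_ofReal]
      refine lintegral_mono fun y => ?_
      rw [← ENNReal.ofReal_add (potential_nonneg (fun b => hp b y) _ _)
        (marginal_nonneg (fun b => hp b y) _ _ _)]
      exact ENNReal.ofReal_le_ofReal (potential_erase_add_marginal_le (fun b => hp b y) i hm)
    have h2 := hCmin (C.erase m) (Finset.mem_univ _)
    have h3 : ((C.erase m)ᶜ.card : ℝ≥0∞) = Cᶜ.card + 1 := by
      rw [Finset.compl_erase, Finset.card_insert_of_notMem (by simpa using hm)]
      push_cast; rfl
    have h4 : Φ (C.erase m) ≠ ∞ := ((le_self_add.trans h1).trans_lt hΦC.lt_top).ne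
    simp only [h3] at h2
    have h5 : (Φ (C.erase m) + β * Cᶜ.card)
        + ∫⁻ y, ENNReal.ofReal (marginal (fun b => p b y) i C m) ∂μ
        ≤ (Φ (C.erase m) + β * Cᶜ.card) + β := by
      calc _ = Φ (C.erase m) + ∫⁻ y, ENNReal.ofReal (marginal (fun b => p b y) i C m) ∂μ
            + β * Cᶜ.card := by ring
        _ ≤ Φ C + β * Cᶜ.card := by gcongr
        _ ≤ Φ (C.erase m) + β * (Cᶜ.card + 1) := h2
        _ = _ := by ring
    exact (ENNReal.add_le_add_iff_left (ENNReal.add_ne_top.2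
      ⟨h4, ENNReal.mul_ne_top hβt (by simp)⟩)).1 h5
  -- A uniformly random set of `|C| - M ≤ D` words is now deleted from `C`; its expected harm is
  -- small, because the trimming already accounts for any `i` deleted competitors.
  set 𝒬 := C.powersetCard (C.card - M) with h𝒬
  have h𝒬ne : 𝒬.Nonempty := Finset.powersetCard_nonempty.2 (Nat.sub_le _ _)
  have hCle : C.card ≤ M + D := by simpa using Finset.card_le_univ C
  have hC0 : (0 : ℝ) < C.card := by exact_mod_cast hM.trans_le hCcard
  set fail : Finset (Fin (M + D)) → Fin (M + D) → Fin (M + D) → Ω → ℝ := fun Q m b y =>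
    if ∑ c ∈ ((C.erase b).erase m) \ Q, p c y
      < trimmedSum (fun b => p b y) i ((C.erase b).erase m) / 2 then p m y else 0 with hfail
  have hfail0 : ∀ Q m b y, 0 ≤ fail Q m b y := fun Q m b y => by
    simp only [hfail]; split_ifs; exacts [hp m y, le_rfl]
  have hfailm : ∀ Q m b, Measurable (fail Q m b) := fun Q m b =>
    Measurable.ite (measurableSet_lt (Finset.measurable_sum _ fun c _ => hpm c)
      ((Measurable.trimmedSum hpm i _).div_const _)) (hpm m) measurable_const
  set δ : ℝ := (2 * (D / M)) ^ i with hδ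
  have hδ0 : 0 ≤ δ := by positivity
  have hpair : ∀ m b, ∑ Q ∈ 𝒬, ∫⁻ y, ENNReal.ofReal (fail Q m b y) ∂μ
      ≤ ENNReal.ofReal (δ * 𝒬.card) := by
    intro m b
    rw [← lintegral_finsetSum _ fun Q _ => (hfailm Q m b).ennreal_ofReal]
    calc _ ≤ ∫⁻ y, ENNReal.ofReal (δ * 𝒬.card) * ENNReal.ofReal (p m y) ∂μ := by
          refine lintegral_mono fun y => ?_
          rw [← ENNReal.ofReal_sum_of_nonneg fun Q _ => hfail0 Q m b y,
            ← ENNReal.ofReal_mul (by positivity)]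
          refine ENNReal.ofReal_le_ofReal ?_
          simp only [hfail]
          rw [← Finset.sum_filter, Finset.sum_const, nsmul_eq_mul]
          refine mul_le_mul_of_nonneg_right ?_ (hp m y)
          refine card_filter_sum_sdiff_lt_le (fun c => hp c y) 𝒬 (by positivity) fun J hJ hJi => ?_
          refine (card_filter_subset_powersetCard_le (hJ.trans ((Finset.erase_subset _ _).trans
            (Finset.erase_subset _ _))) (Nat.sub_le _ _)).trans ?_
          rw [hJi]
          gcongr
          · exact_mod_cast (by omega : C.card - M ≤ D)
      _ = ENNReal.ofReal (δ * 𝒬.card) * ∫⁻ y, ENNReal.ofReal (p m y) ∂μ :=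
          lintegral_const_mul _ (hpm m).ennreal_ofReal
      _ ≤ ENNReal.ofReal (δ * 𝒬.card) * 1 := by gcongr; exact hp1 m
      _ = _ := mul_one _
  obtain ⟨Q, hQ, hQsum⟩ : ∃ Q ∈ 𝒬, ∑ m, ∑ b, ∫⁻ y, ENNReal.ofReal (fail Q m b y) ∂μ
      ≤ ENNReal.ofReal ((M + D) ^ 2 * δ) := by
    refine ENNReal.exists_le_of_sum_le h𝒬ne ?_
    rw [Finset.sum_comm]
    calc _ = ∑ m, ∑ b, ∑ Q ∈ 𝒬, ∫⁻ y, ENNReal.ofReal (fail Q m b y) ∂μ :=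
          Finset.sum_congr rfl fun m _ => Finset.sum_comm
      _ ≤ ∑ m : Fin (M + D), ∑ b : Fin (M + D), ENNReal.ofReal (δ * 𝒬.card) :=
          Finset.sum_le_sum fun m _ => Finset.sum_le_sum fun b _ => hpair m b
      _ = ∑ Q ∈ 𝒬, ENNReal.ofReal ((M + D) ^ 2 * δ) := by
          simp only [Finset.sum_const, Finset.card_univ, Fintype.card_fin, nsmul_eq_mul]
          rw [← ENNReal.ofReal_natCast 𝒬.card, ← ENNReal.ofReal_natCast (M + D),
            ← ENNReal.ofReal_mul (by positivity), ← ENNReal.ofReal_mul (by positivity),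
            ← ENNReal.ofReal_mul (by positivity)]
          congr 1; push_cast; ring
  have hQC := Finset.mem_powersetCard.1 hQ
  refine ⟨C \ Q, ?_, ?_⟩
  · rw [Finset.card_sdiff_of_subset hQC.1, hQC.2]; omega
  intro T hT m hm top htop
  have hmC : m ∈ C := (Finset.mem_sdiff.1 hm).1
  have hfs : ∀ y, 0 ≤ ∑ b ∈ C.erase m, fail Q m b y := fun y =>
    Finset.sum_nonneg fun b _ => hfail0 Q m b y
  calc _ ≤ ∫⁻ y, (ENNReal.ofReal (Real.exp (-T)) * ENNReal.ofReal (p m y)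
        + 4 * ENNReal.ofReal (marginal (fun b => p b y) i C m)
        + ENNReal.ofReal (Real.exp T) * ∑ b ∈ C.erase m, ENNReal.ofReal (fail Q m b y)) ∂μ := by
        refine lintegral_mono fun y => ?_
        rw [← ENNReal.ofReal_sum_of_nonneg fun b _ => hfail0 Q m b y,
          ← ENNReal.ofReal_mul (Real.exp_pos _).le, ← ENNReal.ofReal_mul (Real.exp_pos _).le,
          show (4 : ℝ≥0∞) = ENNReal.ofReal 4 by simp, ← ENNReal.ofReal_mul (by norm_num),
          ← ENNReal.ofReal_add (mul_nonneg (Real.exp_pos _).le (hp m y))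
            (mul_nonneg (by norm_num) (marginal_nonneg (fun b => hp b y) _ _ _)),
          ← ENNReal.ofReal_add (add_nonneg (mul_nonneg (Real.exp_pos _).le (hp m y))
            (mul_nonneg (by norm_num) (marginal_nonneg (fun b => hp b y) _ _ _)))
            (mul_nonneg (Real.exp_pos _).le (hfs y))]
        refine ENNReal.ofReal_le_ofReal ?_
        rw [mul_comm (Real.exp (-T))]
        exact mul_exp_signedTrust_le_marginal (fun b => hp b y) hT i (htop y).1 hm (htop y).2
    _ = ENNReal.ofReal (Real.exp (-T)) * ∫⁻ y, ENNReal.ofReal (p m y) ∂μ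
        + 4 * ∫⁻ y, ENNReal.ofReal (marginal (fun b => p b y) i C m) ∂μ
        + ENNReal.ofReal (Real.exp T)
          * ∑ b ∈ C.erase m, ∫⁻ y, ENNReal.ofReal (fail Q m b y) ∂μ := by
        have hm1 := (hpm m).ennreal_ofReal
        have hm2 := (hmargm C m).ennreal_ofReal
        have hm3 : ∀ b, Measurable fun y => ENNReal.ofReal (fail Q m b y) := fun b =>
          (hfailm Q m b).ennreal_ofReal
        have hm12 : Measurable fun y => ENNReal.ofReal (Real.exp (-T)) * ENNReal.ofReal (p m y)
            + 4 * ENNReal.ofReal (marginal (fun b => p b y) i C m) :=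
          (hm1.const_mul _).add (hm2.const_mul _)
        rw [lintegral_add_left hm12, lintegral_add_left (hm1.const_mul _), lintegral_const_mul _ hm1,
          lintegral_const_mul _ hm2,
          lintegral_const_mul _ (Finset.measurable_sum _ fun b _ => hm3 b),
          lintegral_finsetSum _ fun b _ => hm3 b]
    _ ≤ ENNReal.ofReal (Real.exp (-T)) * 1 + 4 * β
        + ENNReal.ofReal (Real.exp T) * ENNReal.ofReal ((M + D) ^ 2 * δ) := by
        gcongr
        · exact hp1 m
        · exact hmarg m hmC
        · refine le_trans ?_ hQsum
          refine (Finset.sum_le_sum_of_subset (Finset.subset_univ _)).trans ?_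
          exact Finset.single_le_sum
            (f := fun m => ∑ b, ∫⁻ y, ENNReal.ofReal (fail Q m b y) ∂μ)
            (fun _ _ => zero_le) (Finset.mem_univ m)
    _ = _ := by
        rw [mul_one, hβ, show (4 : ℝ≥0∞) = ENNReal.ofReal 4 by simp,
          ← ENNReal.ofReal_mul (by norm_num), ← ENNReal.ofReal_mul (Real.exp_pos _).le,
          ← ENNReal.ofReal_add (Real.exp_pos _).le (by positivity),
          ← ENNReal.ofReal_add (by positivity) (by positivity)]

/-! ### Product measures -/

lemma lintegral_pi_prod {n : ℕ} {E : Fin n → Type*} [∀ j, MeasurableSpace (E j)]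
    (μ : ∀ j, Measure (E j)) [∀ j, SigmaFinite (μ j)] {f : ∀ j, E j → ℝ≥0∞}
    (hf : ∀ j, Measurable (f j)) :
    ∫⁻ x, ∏ j, f j (x j) ∂Measure.pi μ = ∏ j, ∫⁻ t, f j t ∂μ j := by
  induction n with
  | zero => simp [Measure.pi_of_empty μ]
  | succ n ih =>
    have hmp := (measurePreserving_piFinSuccAbove μ 0).symm
    rw [← hmp.lintegral_comp_emb (MeasurableEquiv.measurableEmbedding _)]
    have h1 : ∀ z : E 0 × (∀ j : Fin n, E ((0 : Fin (n + 1)).succAbove j)),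
        ∏ j, f j ((MeasurableEquiv.piFinSuccAbove E 0).symm z j)
        = f 0 z.1 * ∏ j : Fin n, f ((0 : Fin (n + 1)).succAbove j) (z.2 j) := by
      intro z
      rw [Fin.prod_univ_succAbove _ 0]
      rfl
    have hm : Measurable fun z : ∀ j : Fin n, E ((0 : Fin (n + 1)).succAbove j) =>
        ∏ j : Fin n, f ((0 : Fin (n + 1)).succAbove j) (z j) :=
      Finset.measurable_prod _ fun j _ => (hf _).comp (measurable_pi_apply j)
    simp_rw [h1]
    rw [lintegral_prod_mul (hf 0).aemeasurable hm.aemeasurable,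
      ih (fun j => μ ((0 : Fin (n + 1)).succAbove j)) fun j => hf _,
      Fin.prod_univ_succAbove (fun j => ∫⁻ t, f j t ∂μ j) 0]

/-- Jensen's inequality for a concave power. -/
lemma lintegral_rpow_le_rpow_lintegral {Ω : Type*} [MeasurableSpace Ω] (P : Measure Ω)
    [IsProbabilityMeasure P] {f : Ω → ℝ≥0∞} (hf : Measurable f) {s : ℝ} (h0 : 0 ≤ s)
    (h1 : s ≤ 1) : ∫⁻ x, f x ^ s ∂P ≤ (∫⁻ x, f x ∂P) ^ s := by
  have := ENNReal.lintegral_mul_norm_pow_le (μ := P) hf.aemeasurable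
    (g := fun _ => 1) aemeasurable_const h0 (by linarith : 0 ≤ 1 - s) (by ring)
  simpa using this

/-- Jensen's inequality for a convex power. -/
lemma rpow_lintegral_le_lintegral_rpow {Ω : Type*} [MeasurableSpace Ω] (P : Measure Ω)
    [IsProbabilityMeasure P] {f : Ω → ℝ≥0∞} (hf : Measurable f) {s : ℝ} (h1 : 1 ≤ s) :
    (∫⁻ x, f x ∂P) ^ s ≤ ∫⁻ x, f x ^ s ∂P := by
  have hs : 0 < s := by linarith
  have h := lintegral_rpow_le_rpow_lintegral P (hf.pow_const s) (s := s⁻¹) (by positivity)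
    (inv_le_one_of_one_le₀ h1)
  simp_rw [← ENNReal.rpow_mul, mul_inv_cancel₀ hs.ne', ENNReal.rpow_one] at h
  calc _ ≤ ((∫⁻ x, f x ^ s ∂P) ^ s⁻¹) ^ s := ENNReal.rpow_le_rpow h hs.le
    _ = _ := by rw [← ENNReal.rpow_mul, inv_mul_cancel₀ hs.ne', ENNReal.rpow_one]

section ensemble
variable {𝓧 : Type*} [MeasurableSpace 𝓧] {N : ℕ} (P : Measure 𝓧) [IsProbabilityMeasure P]

lemma lintegral_pi_eval {F : 𝓧 → ℝ≥0∞} (hF : Measurable F) (a : Fin N) :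
    ∫⁻ c, F (c a) ∂Measure.pi (fun _ : Fin N => P) = ∫⁻ x, F x ∂P :=
  (measurePreserving_eval (fun _ : Fin N => P) a).lintegral_comp hF

lemma lintegral_pi_eval_pair {H : 𝓧 × 𝓧 → ℝ≥0∞} (hH : Measurable H) {a b : Fin N}
    (hab : a ≠ b) :
    ∫⁻ c, H (c a, c b) ∂Measure.pi (fun _ : Fin N => P) = ∫⁻ x, ∫⁻ x', H (x, x') ∂P ∂P := by
  have hi : iIndepFun (fun (i : Fin N) (c : Fin N → 𝓧) => c i) (Measure.pi fun _ : Fin N => P) :=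
    iIndepFun_pi (X := fun _ x => x) fun _ => aemeasurable_id
  have h := (hi.indepFun hab).map_prod_eq_prod_map_map
    (measurable_pi_apply a).aemeasurable (measurable_pi_apply b).aemeasurable
  have ha : (Measure.pi fun _ : Fin N => P).map (fun c => c a) = P :=
    (measurePreserving_eval (fun _ : Fin N => P) a).map_eq
  have hb : (Measure.pi fun _ : Fin N => P).map (fun c => c b) = P :=
    (measurePreserving_eval (fun _ : Fin N => P) b).map_eq
  rw [ha, hb] at h
  rw [← lintegral_prod _ hH.aemeasurable, ← h,
    lintegral_map hH ((measurable_pi_apply a).prodMk (measurable_pi_apply b))]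

/-- Gallager's ensemble average for a fixed output: one word is independent of the sum over the
other words, to which Jensen's inequality applies. -/
lemma lintegral_pi_mul_rpow_sum_le {F : 𝓧 → ℝ≥0∞} (hF : Measurable F) {ρ : ℝ} (h0 : 0 ≤ ρ)
    (h1 : ρ ≤ 1) (a : Fin N) :
    ∫⁻ c, F (c a) * (∑ b ∈ Finset.univ.erase a, F (c b)) ^ ρ ∂Measure.pi (fun _ : Fin N => P)
      ≤ (N : ℝ≥0∞) ^ ρ * (∫⁻ x, F x ∂P) ^ (1 + ρ) := by
  have hi : iIndepFun (fun (i : Fin N) (c : Fin N → 𝓧) => F (c i))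
      (Measure.pi fun _ : Fin N => P) :=
    iIndepFun_pi (X := fun _ x => F x) fun _ => hF.aemeasurable
  have hFm : ∀ i : Fin N, Measurable fun c : Fin N → 𝓧 => F (c i) := fun i =>
    hF.comp (measurable_pi_apply i)
  have hsm : Measurable fun c : Fin N → 𝓧 => ∑ b ∈ Finset.univ.erase a, F (c b) :=
    Finset.measurable_sum _ fun b _ => hFm b
  have hind := (hi.indepFun_finsetSum_of_notMem hFm (Finset.notMem_erase a Finset.univ)).symm
  have hind' : IndepFun (fun c : Fin N → 𝓧 => F (c a))
      (fun c => (∑ b ∈ Finset.univ.erase a, F (c b)) ^ ρ) (Measure.pi fun _ : Fin N => P) := by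
    have he : (fun c : Fin N → 𝓧 => (∑ b ∈ Finset.univ.erase a, F (c b)) ^ ρ)
        = (fun z : ℝ≥0∞ => z ^ ρ) ∘ ∑ b ∈ Finset.univ.erase a, fun c : Fin N → 𝓧 => F (c b) := by
      ext c
      simp only [Function.comp, Finset.sum_apply]
    rw [he]
    exact hind.comp measurable_id (measurable_id.pow_const ρ)
  have hmul := lintegral_mul_eq_lintegral_mul_lintegral_of_indepFun (hFm a)
    (hsm.pow_const ρ) hind'
  simp only [Pi.mul_apply] at hmul
  rw [hmul, lintegral_pi_eval P hF]
  have hsum : ∫⁻ c, ∑ b ∈ Finset.univ.erase a, F (c b) ∂Measure.pi (fun _ : Fin N => P)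
      ≤ N * ∫⁻ x, F x ∂P := by
    rw [lintegral_finsetSum _ fun b _ => hFm b]
    simp_rw [lintegral_pi_eval P hF]
    rw [Finset.sum_const, nsmul_eq_mul]
    gcongr
    exact (Finset.card_le_univ _).trans_eq (Fintype.card_fin N)
  calc _ ≤ (∫⁻ x, F x ∂P) * (N * ∫⁻ x, F x ∂P) ^ ρ := by
        gcongr
        exact (lintegral_rpow_le_rpow_lintegral _ hsm h0 h1).trans
          (ENNReal.rpow_le_rpow hsum h0)
    _ = _ := by
        rw [ENNReal.mul_rpow_of_nonneg _ _ h0, ENNReal.rpow_add_of_nonneg _ _ zero_le_one h0,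
          ENNReal.rpow_one]
        ring

end ensemble

namespace MemorylessChannel

variable {X Y : Type*} [MeasurableSpace X] [MeasurableSpace Y] (W : MemorylessChannel X Y)

/-! ### Blocks of channel uses -/

/-- The product reference measure on output blocks. -/
noncomputable def refBlock (n : ℕ) : Measure (Fin n → Y) := Measure.pi fun _ => W.ref

instance (n : ℕ) : SigmaFinite (W.refBlock n) := by unfold refBlock; infer_instance

lemma measurable_w_right (x : X) : Measurable (W.w x) :=
  W.measurable_w.comp (measurable_const.prodMk measurable_id)

lemma measurable_w_left (y : Y) : Measurable fun x => W.w x y :=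
  W.measurable_w.comp (measurable_id.prodMk measurable_const)

lemma measurable_uncurry_lik (n : ℕ) :
    Measurable fun z : (Fin n → X) × (Fin n → Y) => W.lik z.1 z.2 :=
  Finset.measurable_prod _ fun j _ => W.measurable_w.comp
    (f := fun z : (Fin n → X) × (Fin n → Y) => (z.1 j, z.2 j))
    (((measurable_pi_apply j).comp measurable_fst).prodMk
      ((measurable_pi_apply j).comp measurable_snd))

lemma measurable_lik {n : ℕ} (x : Fin n → X) : Measurable (W.lik x) :=
  (W.measurable_uncurry_lik n).comp (measurable_const.prodMk measurable_id)

lemma blockLaw_eq_withDensity {n : ℕ} (x : Fin n → X) :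
    W.blockLaw x = (W.refBlock n).withDensity fun y => (W.lik x y : ℝ≥0∞) := by
  symm
  have h : ∀ j, W.kernel (x j) = W.ref.withDensity fun y => (W.w (x j) y : ℝ≥0∞) := fun j =>
    W.kernel_apply (x j)
  have : ∀ j, SigmaFinite (W.ref.withDensity fun y => (W.w (x j) y : ℝ≥0∞)) := fun j => by
    rw [← h j]; infer_instance
  unfold blockLaw
  simp_rw [h]
  symm
  refine Measure.pi_eq fun s hs => ?_
  rw [withDensity_apply _ (MeasurableSet.univ_pi hs), ← lintegral_indicator
    (MeasurableSet.univ_pi hs)]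
  have h1 : ∀ y : Fin n → Y, (Set.univ.pi s).indicator (fun y => (W.lik x y : ℝ≥0∞)) y
      = ∏ j, (s j).indicator (fun t => (W.w (x j) t : ℝ≥0∞)) (y j) := by
    intro y
    by_cases hy : y ∈ Set.univ.pi s
    · rw [Set.indicator_of_mem hy, lik, ENNReal.ofNNReal_finsetProd]
      exact Finset.prod_congr rfl fun j _ => by
        rw [Set.indicator_of_mem (hy j (Set.mem_univ j))]
    · rw [Set.indicator_of_notMem hy]
      obtain ⟨j, hj⟩ : ∃ j, y j ∉ s j := by
        by_contra! hc
        exact hy fun j _ => hc j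
      exact (Finset.prod_eq_zero (Finset.mem_univ j) (Set.indicator_of_notMem hj _)).symm
  simp_rw [h1]
  rw [refBlock, lintegral_pi_prod _ fun j =>
    ((W.measurable_w_right (x j)).coe_nnreal_ennreal).indicator (hs j)]
  exact Finset.prod_congr rfl fun j _ => by
    rw [lintegral_indicator (hs j), withDensity_apply _ (hs j)]

instance {n : ℕ} (x : Fin n → X) : IsProbabilityMeasure (W.blockLaw x) := by
  unfold blockLaw; infer_instance

lemma lintegral_blockLaw {n : ℕ} (x : Fin n → X) (f : (Fin n → Y) → ℝ≥0∞) :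
    ∫⁻ y, f y ∂W.blockLaw x = ∫⁻ y, (W.lik x y : ℝ≥0∞) * f y ∂W.refBlock n := by
  rw [blockLaw_eq_withDensity, lintegral_withDensity_eq_lintegral_mul_non_measurable _
    (W.measurable_lik x).coe_nnreal_ennreal (by simp)]
  rfl

lemma lintegral_lik {n : ℕ} (x : Fin n → X) :
    ∫⁻ y, (W.lik x y : ℝ≥0∞) ∂W.refBlock n = 1 := by
  have := W.lintegral_blockLaw x 1
  simpa using this.symm

/-! ### Random coding -/

/-- The law of a random codeword with independent letters. -/
noncomputable def wordLaw (p : ProbabilityMeasure X) (n : ℕ) : Measure (Fin n → X) :=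
  Measure.pi fun _ => (p : Measure X)

instance (p : ProbabilityMeasure X) (n : ℕ) : IsProbabilityMeasure (wordLaw p n) := by
  unfold wordLaw; infer_instance

/-- The integral inside Gallager's function `E₀`. -/
noncomputable def gallagerIntegral (p : ProbabilityMeasure X) (ρ : ℝ) : ℝ≥0∞ :=
  ∫⁻ y, (∫⁻ x, (W.w x y : ℝ≥0∞) ^ (1 / (1 + ρ)) ∂(p : Measure X)) ^ (1 + ρ) ∂W.ref

lemma measurable_uncurry_w_coe :
    Measurable fun z : X × Y => (W.w z.1 z.2 : ℝ≥0∞) := W.measurable_w.coe_nnreal_ennreal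

lemma gallagerIntegral_le_one (p : ProbabilityMeasure X) {ρ : ℝ} (h0 : 0 ≤ ρ) :
    W.gallagerIntegral p ρ ≤ 1 := by
  have hρ : 1 + ρ ≠ 0 := by linarith
  calc W.gallagerIntegral p ρ
      ≤ ∫⁻ y, ∫⁻ x, (W.w x y : ℝ≥0∞) ∂(p : Measure X) ∂W.ref := by
        refine lintegral_mono fun y => ?_
        refine (rpow_lintegral_le_lintegral_rpow _
          ((W.measurable_w_left y).coe_nnreal_ennreal.pow_const _) (by linarith)).trans_eq ?_
        simp_rw [← ENNReal.rpow_mul, one_div, inv_mul_cancel₀ hρ, ENNReal.rpow_one]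
    _ = ∫⁻ x, ∫⁻ y, (W.w x y : ℝ≥0∞) ∂W.ref ∂(p : Measure X) :=
        lintegral_lintegral_swap (W.measurable_uncurry_w_coe.comp measurable_swap).aemeasurable
    _ = 1 := by simp [W.lintegral_w]

lemma le_ofReal_exp_log_toReal {J : ℝ≥0∞} (hJ : J ≠ ∞) :
    J ≤ ENNReal.ofReal (Real.exp (Real.log J.toReal)) := by
  rw [← ENNReal.ofReal_toReal hJ]
  refine ENNReal.ofReal_le_ofReal ?_
  rw [ENNReal.toReal_ofReal ENNReal.toReal_nonneg]
  exact Real.le_exp_log _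

lemma gallagerIntegral_le_exp (p : ProbabilityMeasure X) {ρ : ℝ} (h0 : 0 ≤ ρ) :
    W.gallagerIntegral p ρ ≤ ENNReal.ofReal (Real.exp (-W.E0 p ρ)) := by
  have h := le_ofReal_exp_log_toReal
    ((W.gallagerIntegral_le_one p h0).trans_lt ENNReal.one_lt_top).ne
  rwa [E0, neg_neg]

/-- The confusion is at most every weighted geometric mean of `x` and `S` with a weight `s ≤ 1 / 2`
on `S`; Gallager's bound uses `s = ρ / (1 + ρ)`. -/
lemma confusion_le_rpow_mul_rpow {x S s : ℝ} (hx : 0 ≤ x) (hS : 0 ≤ S) (h0 : 0 ≤ s)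
    (h1 : s ≤ 1 / 2) : confusion x S ≤ x ^ (1 - s) * S ^ s := by
  rcases hx.eq_or_lt with rfl | hx
  · exact (min_le_left _ _).trans (by positivity)
  have h2 : x ^ (1 - s) * S ^ s = x * (S / x) ^ s := by
    rw [Real.div_rpow hS hx.le, Real.rpow_sub hx, Real.rpow_one]
    field_simp
  rw [h2]
  rcases le_total 1 (S / x) with h | h
  · refine (min_le_left _ _).trans ?_
    have := Real.one_le_rpow h h0
    nlinarith
  · refine (min_le_right _ _).trans ?_
    rw [show x * S = x ^ 2 * (S / x) by field_simp, Real.sqrt_mul (by positivity),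
      Real.sqrt_sq hx.le, Real.sqrt_eq_rpow]
    exact mul_le_mul_of_nonneg_left
      (Real.rpow_le_rpow_of_exponent_ge' (by positivity) h h0 h1) hx.le

lemma rpow_sum_le_sum_rpow {ι : Type*} (I : Finset ι) (f : ι → ℝ≥0∞) {s : ℝ} (h0 : 0 < s)
    (h1 : s ≤ 1) : (∑ b ∈ I, f b) ^ s ≤ ∑ b ∈ I, f b ^ s := by
  classical
  induction I using Finset.induction_on with
  | empty => simp [h0]
  | insert a I ha ih =>
    rw [Finset.sum_insert ha, Finset.sum_insert ha]
    exact (ENNReal.rpow_add_le_add_rpow _ _ h0.le h1).trans (by gcongr)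

lemma ofReal_confusion_le {ι : Type*} (I : Finset ι) (x : ℝ≥0) (f : ι → ℝ≥0) {ρ : ℝ}
    (h0 : 0 ≤ ρ) (h1 : ρ ≤ 1) :
    ENNReal.ofReal (confusion x (∑ b ∈ I, (f b : ℝ)))
      ≤ (x : ℝ≥0∞) ^ (1 / (1 + ρ)) * (∑ b ∈ I, (f b : ℝ≥0∞) ^ (1 / (1 + ρ))) ^ ρ := by
  have hρ : 0 < 1 + ρ := by linarith
  have hs0 : 0 ≤ ρ / (1 + ρ) := by positivity
  have hs1 : ρ / (1 + ρ) ≤ 1 / 2 := by rw [div_le_div_iff₀ hρ two_pos]; linarith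
  have hS : 0 ≤ ∑ b ∈ I, (f b : ℝ) := Finset.sum_nonneg fun b _ => (f b).coe_nonneg
  refine (ENNReal.ofReal_le_ofReal
    (confusion_le_rpow_mul_rpow x.coe_nonneg hS hs0 hs1)).trans ?_
  have e1 : 1 - ρ / (1 + ρ) = 1 / (1 + ρ) := by field_simp; ring
  rw [ENNReal.ofReal_mul (by positivity), e1,
    ← ENNReal.ofReal_rpow_of_nonneg x.coe_nonneg (by positivity),
    ← ENNReal.ofReal_rpow_of_nonneg hS hs0, ENNReal.ofReal_coe_nnreal,
    ENNReal.ofReal_sum_of_nonneg fun b _ => (f b).coe_nonneg]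
  simp_rw [ENNReal.ofReal_coe_nnreal]
  gcongr
  rw [show ρ / (1 + ρ) = 1 / (1 + ρ) * ρ by ring, ENNReal.rpow_mul]
  refine ENNReal.rpow_le_rpow (rpow_sum_le_sum_rpow _ _ (by positivity) ?_) h0
  rw [div_le_one hρ]; linarith

/-- Gallager's random coding bound: some list of `N` words has total confusion at most
`N ^ (1 + ρ) exp (-n E₀(ρ, p))`. -/
lemma exists_list_confusion_le (p : ProbabilityMeasure X) {ρ : ℝ} (h0 : 0 ≤ ρ) (h1 : ρ ≤ 1)
    (n N : ℕ) :
    ∃ c : Fin N → Fin n → X, ∑ a, ∫⁻ y, ENNReal.ofReal (confusion (W.lik (c a) y)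
        (∑ b ∈ Finset.univ.erase a, (W.lik (c b) y : ℝ))) ∂W.refBlock n
      ≤ N * ((N : ℝ≥0∞) ^ ρ * W.gallagerIntegral p ρ ^ n) := by
  set F : (Fin n → X) → (Fin n → Y) → ℝ≥0∞ := fun c y => (W.lik c y : ℝ≥0∞) ^ (1 / (1 + ρ))
    with hF
  have hFm : Measurable fun z : (Fin n → X) × (Fin n → Y) => F z.1 z.2 :=
    (W.measurable_uncurry_lik n).coe_nnreal_ennreal.pow_const _
  have hFmy : ∀ y, Measurable fun c => F c y := fun y =>
    hFm.comp (measurable_id.prodMk measurable_const)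
  set A : Y → ℝ≥0∞ := fun t => ∫⁻ x, (W.w x t : ℝ≥0∞) ^ (1 / (1 + ρ)) ∂(p : Measure X) with hA
  have hAm : Measurable A :=
    Measurable.lintegral_prod_left' (f := fun z : X × Y => (W.w z.1 z.2 : ℝ≥0∞) ^ (1 / (1 + ρ)))
      (W.measurable_uncurry_w_coe.pow_const _)
  have hFA : ∀ y, ∫⁻ c, F c y ∂wordLaw p n = ∏ j, A (y j) := by
    intro y
    rw [wordLaw, ← lintegral_pi_prod (fun _ : Fin n => (p : Measure X))
      (f := fun j x => (W.w x (y j) : ℝ≥0∞) ^ (1 / (1 + ρ)))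
      fun j => (W.measurable_w_left (y j)).coe_nnreal_ennreal.pow_const _]
    refine lintegral_congr fun c => ?_
    simp only [hF, lik]
    rw [ENNReal.ofNNReal_finsetProd, ENNReal.prod_rpow_of_nonneg (by positivity)]
  have hAint : ∫⁻ y, (∏ j, A (y j)) ^ (1 + ρ) ∂W.refBlock n = W.gallagerIntegral p ρ ^ n := by
    simp_rw [← ENNReal.prod_rpow_of_nonneg (by linarith : (0 : ℝ) ≤ 1 + ρ)]
    rw [refBlock, lintegral_pi_prod _ fun _ => hAm.pow_const _]
    simp [gallagerIntegral, hA]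
  set V : (Fin N → Fin n → X) → ℝ≥0∞ := fun c => ∑ a, ∫⁻ y,
    F (c a) y * (∑ b ∈ Finset.univ.erase a, F (c b) y) ^ ρ ∂W.refBlock n with hV
  have hFc : ∀ b : Fin N, Measurable fun z : (Fin N → Fin n → X) × (Fin n → Y) =>
      F (z.1 b) z.2 := fun b =>
    hFm.comp (f := fun z : (Fin N → Fin n → X) × (Fin n → Y) => (z.1 b, z.2))
      (((measurable_pi_apply b).comp measurable_fst).prodMk measurable_snd)
  have hjm : ∀ a : Fin N, Measurable fun z : (Fin N → Fin n → X) × (Fin n → Y) =>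
      F (z.1 a) z.2 * (∑ b ∈ Finset.univ.erase a, F (z.1 b) z.2) ^ ρ := fun a =>
    (hFc a).mul ((Finset.measurable_sum _ fun b _ => hFc b).pow_const ρ)
  have hVm : ∀ a : Fin N, Measurable fun c : Fin N → Fin n → X => ∫⁻ y,
      F (c a) y * (∑ b ∈ Finset.univ.erase a, F (c b) y) ^ ρ ∂W.refBlock n := fun a =>
    (hjm a).lintegral_prod_right'
  obtain ⟨c, hc⟩ := exists_le_lintegral (μ := Measure.pi fun _ : Fin N => wordLaw p n) (f := V)
    (Finset.measurable_sum _ fun a _ => hVm a).aemeasurable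
  refine ⟨c, le_trans (Finset.sum_le_sum fun a _ => lintegral_mono fun y => ?_) (hc.trans ?_)⟩
  · exact ofReal_confusion_le _ _ _ h0 h1
  rw [hV, lintegral_finsetSum _ fun a _ => hVm a]
  calc _ ≤ ∑ a : Fin N, (N : ℝ≥0∞) ^ ρ * W.gallagerIntegral p ρ ^ n := by
        refine Finset.sum_le_sum fun a _ => ?_
        rw [lintegral_lintegral_swap (hjm a).aemeasurable, ← hAint]
        have hpm : Measurable fun y : Fin n → Y => (∏ j, A (y j)) ^ (1 + ρ) :=
          (Finset.measurable_prod _ fun j _ => hAm.comp (measurable_pi_apply j)).pow_const _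
        rw [← lintegral_const_mul _ hpm]
        refine lintegral_mono fun y => ?_
        rw [← hFA]
        exact lintegral_pi_mul_rpow_sum_le (wordLaw p n) (hFmy y) h0 h1 a
    _ = _ := by simp

end MemorylessChannel

namespace MemorylessChannel

variable {X Y : Type*} [MeasurableSpace X] [MeasurableSpace Y] (W : MemorylessChannel X Y)

/-! ### Expurgation -/

/-- The Bhattacharyya coefficient of two input letters. -/
noncomputable def letterBhattacharyya (x x' : X) : ℝ≥0∞ :=
  ∫⁻ y, ((W.w x y : ℝ≥0∞) * (W.w x' y : ℝ≥0∞)) ^ (1 / 2 : ℝ) ∂W.ref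

/-- The Bhattacharyya coefficient of two input blocks. -/
noncomputable def bhattacharyya {n : ℕ} (c c' : Fin n → X) : ℝ≥0∞ :=
  ∫⁻ y, ((W.lik c y : ℝ≥0∞) * (W.lik c' y : ℝ≥0∞)) ^ (1 / 2 : ℝ) ∂W.refBlock n

/-- The integral inside the expurgated function `E_x`. -/
noncomputable def expurgatedIntegral (p : ProbabilityMeasure X) (ρ : ℝ) : ℝ≥0∞ :=
  ∫⁻ x, ∫⁻ x', W.letterBhattacharyya x x' ^ (1 / ρ) ∂(p : Measure X) ∂(p : Measure X)

lemma measurable_letterBhattacharyya :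
    Measurable fun z : X × X => W.letterBhattacharyya z.1 z.2 := by
  have h : Measurable fun z : (X × X) × Y =>
      ((W.w z.1.1 z.2 : ℝ≥0∞) * (W.w z.1.2 z.2 : ℝ≥0∞)) ^ (1 / 2 : ℝ) := by
    have h1 : Measurable fun z : (X × X) × Y => (W.w z.1.1 z.2 : ℝ≥0∞) :=
      W.measurable_uncurry_w_coe.comp (f := fun z : (X × X) × Y => (z.1.1, z.2))
        ((measurable_fst.comp measurable_fst).prodMk measurable_snd)
    have h2 : Measurable fun z : (X × X) × Y => (W.w z.1.2 z.2 : ℝ≥0∞) :=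
      W.measurable_uncurry_w_coe.comp (f := fun z : (X × X) × Y => (z.1.2, z.2))
        ((measurable_snd.comp measurable_fst).prodMk measurable_snd)
    exact (h1.mul h2).pow_const _
  exact h.lintegral_prod_right'

lemma bhattacharyya_eq_prod {n : ℕ} (c c' : Fin n → X) :
    W.bhattacharyya c c' = ∏ j, W.letterBhattacharyya (c j) (c' j) := by
  unfold bhattacharyya letterBhattacharyya
  rw [refBlock, ← lintegral_pi_prod (fun _ : Fin n => W.ref)
    (f := fun j y => ((W.w (c j) y : ℝ≥0∞) * (W.w (c' j) y : ℝ≥0∞)) ^ (1 / 2 : ℝ))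
    fun j => ((W.measurable_w_right _).coe_nnreal_ennreal.mul
      (W.measurable_w_right _).coe_nnreal_ennreal).pow_const _]
  refine lintegral_congr fun y => ?_
  rw [ENNReal.prod_rpow_of_nonneg (by norm_num), Finset.prod_mul_distrib, lik, lik,
    ENNReal.ofNNReal_finsetProd, ENNReal.ofNNReal_finsetProd]

lemma letterBhattacharyya_le_one (x x' : X) : W.letterBhattacharyya x x' ≤ 1 := by
  have h := ENNReal.lintegral_mul_norm_pow_le (μ := W.ref)
    (W.measurable_w_right x).coe_nnreal_ennreal.aemeasurable
    (W.measurable_w_right x').coe_nnreal_ennreal.aemeasurable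
    (p := 1 / 2) (q := 1 / 2) (by norm_num) (by norm_num) (by norm_num)
  rw [W.lintegral_w, W.lintegral_w, ENNReal.one_rpow, one_mul] at h
  refine le_trans (lintegral_mono fun y => ?_) h
  rw [ENNReal.mul_rpow_of_nonneg _ _ (by norm_num)]

lemma expurgatedIntegral_le_one (p : ProbabilityMeasure X) {ρ : ℝ} (h : 0 ≤ ρ) :
    W.expurgatedIntegral p ρ ≤ 1 := by
  calc W.expurgatedIntegral p ρ ≤ ∫⁻ _, ∫⁻ _, 1 ∂(p : Measure X) ∂(p : Measure X) :=
        lintegral_mono fun x => lintegral_mono fun x' =>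
          ENNReal.rpow_le_one (W.letterBhattacharyya_le_one x x') (by positivity)
    _ = 1 := by simp

lemma expurgatedIntegral_rpow_le_exp (p : ProbabilityMeasure X) {ρ : ℝ} (h : 0 ≤ ρ) :
    W.expurgatedIntegral p ρ ^ ρ ≤ ENNReal.ofReal (Real.exp (-W.Ex p ρ)) := by
  have h1 := le_ofReal_exp_log_toReal
    ((W.expurgatedIntegral_le_one p h).trans_lt ENNReal.one_lt_top).ne
  refine (ENNReal.rpow_le_rpow h1 h).trans ?_
  rw [ENNReal.ofReal_rpow_of_pos (Real.exp_pos _), ← Real.exp_mul]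
  refine ENNReal.ofReal_le_ofReal (Real.exp_le_exp.2 (le_of_eq ?_))
  simp only [Ex, expurgatedIntegral, letterBhattacharyya]
  ring

/-- Gallager's expurgation: in some list of `N` words the powers `1 / ρ` of the Bhattacharyya
coefficients have a small sum. -/
lemma exists_list_bhattacharyya_le (p : ProbabilityMeasure X) {ρ : ℝ} (h0 : 0 < ρ) (n N : ℕ) :
    ∃ c : Fin N → Fin n → X, ∑ a, ∑ b ∈ Finset.univ.erase a,
        W.bhattacharyya (c a) (c b) ^ (1 / ρ)
      ≤ N * (N * W.expurgatedIntegral p ρ ^ n) := by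
  have hbm : Measurable fun z : (Fin n → X) × (Fin n → X) =>
      W.bhattacharyya z.1 z.2 ^ (1 / ρ) := by
    simp_rw [bhattacharyya_eq_prod]
    refine (Finset.measurable_prod _ fun j _ => ?_).pow_const _
    exact W.measurable_letterBhattacharyya.comp
      (f := fun z : (Fin n → X) × (Fin n → X) => (z.1 j, z.2 j))
      (((measurable_pi_apply j).comp measurable_fst).prodMk
        ((measurable_pi_apply j).comp measurable_snd))
  have hint : ∫⁻ c, ∫⁻ c', W.bhattacharyya c c' ^ (1 / ρ) ∂wordLaw p n ∂wordLaw p n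
      = W.expurgatedIntegral p ρ ^ n := by
    have hl : Measurable fun z : X × X => W.letterBhattacharyya z.1 z.2 ^ (1 / ρ) :=
      W.measurable_letterBhattacharyya.pow_const _
    have h1 : ∀ c : Fin n → X, ∫⁻ c', W.bhattacharyya c c' ^ (1 / ρ) ∂wordLaw p n
        = ∏ j, ∫⁻ x', W.letterBhattacharyya (c j) x' ^ (1 / ρ) ∂(p : Measure X) := by
      intro c
      rw [wordLaw, ← lintegral_pi_prod (fun _ : Fin n => (p : Measure X))
        (f := fun j x' => W.letterBhattacharyya (c j) x' ^ (1 / ρ))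
        fun j => hl.comp (f := fun x' => (c j, x')) (measurable_const.prodMk measurable_id)]
      refine lintegral_congr fun c' => ?_
      rw [bhattacharyya_eq_prod, ENNReal.prod_rpow_of_nonneg (by positivity)]
    simp_rw [h1]
    rw [wordLaw, lintegral_pi_prod (fun _ : Fin n => (p : Measure X))
      (f := fun _ x => ∫⁻ x', W.letterBhattacharyya x x' ^ (1 / ρ) ∂(p : Measure X))
      fun _ => hl.lintegral_prod_right']
    simp [expurgatedIntegral]
  have hcm : ∀ a b : Fin N, Measurable fun c : Fin N → Fin n → X =>
      W.bhattacharyya (c a) (c b) ^ (1 / ρ) := fun a b =>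
    hbm.comp (f := fun c : Fin N → Fin n → X => (c a, c b))
      ((measurable_pi_apply a).prodMk (measurable_pi_apply b))
  obtain ⟨c, hc⟩ := exists_le_lintegral (μ := Measure.pi fun _ : Fin N => wordLaw p n)
    (f := fun c => ∑ a, ∑ b ∈ Finset.univ.erase a, W.bhattacharyya (c a) (c b) ^ (1 / ρ))
    (Finset.measurable_sum _ fun a _ => Finset.measurable_sum _ fun b _ => hcm a b).aemeasurable
  refine ⟨c, hc.trans ?_⟩
  rw [lintegral_finsetSum _ fun a _ => Finset.measurable_sum _ fun b _ => hcm a b]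
  calc _ ≤ ∑ a : Fin N, (N : ℝ≥0∞) * W.expurgatedIntegral p ρ ^ n := by
        refine Finset.sum_le_sum fun a _ => ?_
        rw [lintegral_finsetSum _ fun b _ => hcm a b]
        calc _ = ∑ b ∈ Finset.univ.erase a, W.expurgatedIntegral p ρ ^ n := by
              refine Finset.sum_congr rfl fun b hb => ?_
              rw [lintegral_pi_eval_pair (wordLaw p n)
                (H := fun z => W.bhattacharyya z.1 z.2 ^ (1 / ρ)) hbm
                (Finset.ne_of_mem_erase hb).symm, hint]
          _ ≤ _ := by
              rw [Finset.sum_const, nsmul_eq_mul]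
              gcongr
              exact (Finset.card_le_univ _).trans_eq (Fintype.card_fin N)
    _ = _ := by simp

/-- Half of the elements have at most twice the average weight. -/
lemma exists_subset_card_forall_le {M : ℕ} {θ : Fin (M + M) → ℝ≥0∞} {t : ℝ≥0∞} (ht : t ≠ ∞)
    (h : ∑ a, θ a ≤ M * t) : ∃ S : Finset (Fin (M + M)), S.card = M ∧ ∀ a ∈ S, θ a ≤ t := by
  classical
  set B := Finset.univ.filter fun a => ¬ θ a ≤ t with hB
  set A := Finset.univ.filter fun a => θ a ≤ t with hA
  have hAB : A.card + B.card = M + M := by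
    have := Finset.card_filter_add_card_filter_not (s := (Finset.univ : Finset (Fin (M + M))))
      (fun a => θ a ≤ t)
    rw [hA, hB, this, Finset.card_univ, Fintype.card_fin]
  have hBM : B.card ≤ M := by
    rcases B.eq_empty_or_nonempty with hB0 | ⟨b, hb⟩
    · simp [hB0]
    have h1 : (B.card : ℝ≥0∞) * t ≤ M * t := by
      calc (B.card : ℝ≥0∞) * t = ∑ a ∈ B, t := by simp
        _ ≤ ∑ a ∈ B, θ a := Finset.sum_le_sum fun a ha =>
            (not_le.1 (Finset.mem_filter.1 ha).2).le
        _ ≤ ∑ a, θ a := Finset.sum_le_sum_of_subset (Finset.subset_univ _)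
        _ ≤ _ := h
    rcases eq_or_ne t 0 with rfl | ht0
    · have h2 : θ b ≤ 0 := by
        refine (Finset.single_le_sum (f := θ) (fun _ _ => zero_le)
          (Finset.mem_univ b)).trans (h.trans ?_)
        simp
      exact absurd h2 (Finset.mem_filter.1 hb).2
    · exact_mod_cast (ENNReal.mul_le_mul_iff_left ht0 ht).1 h1
  obtain ⟨S, hSA, hS⟩ := Finset.exists_subset_card_eq (s := A) (n := M) (by omega)
  exact ⟨S, hS, fun a ha => (Finset.mem_filter.1 (hSA ha)).2⟩

/-- Expurgated codes have small exponential moments for every word. -/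
theorem exists_subcode_of_expurgation (p : ProbabilityMeasure X) {ρ : ℝ} (h1 : 1 ≤ ρ) (n M : ℕ) :
    ∃ (c : Fin (M + M) → Fin n → X) (S : Finset (Fin (M + M))), S.card = M ∧
      ∀ T : ℝ, 0 < T → ∀ m ∈ S, ∀ top : (Fin n → Y) → Fin (M + M),
      (∀ y, top y ∈ S ∧ ∀ b ∈ S, (W.lik (c b) y : ℝ) ≤ W.lik (c (top y)) y) →
      ∫⁻ y, ENNReal.ofReal (W.lik (c m) y *
        Real.exp (-(T * signedTrust (fun b => (W.lik (c b) y : ℝ)) S T (top y) m))) ∂W.refBlock n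
      ≤ ENNReal.ofReal (Real.exp (-T))
        + 2 * (4 * M * W.expurgatedIntegral p ρ ^ n) ^ ρ := by
  have h0 : 0 < ρ := by linarith
  obtain ⟨c, hc⟩ := W.exists_list_bhattacharyya_le p h0 n (M + M)
  set K := W.expurgatedIntegral p ρ with hK
  have hKt : K ≠ ∞ := ((W.expurgatedIntegral_le_one p h0.le).trans_lt ENNReal.one_lt_top).ne
  obtain ⟨S, hScard, hS⟩ := exists_subset_card_forall_le
    (θ := fun a => ∑ b ∈ Finset.univ.erase a, W.bhattacharyya (c a) (c b) ^ (1 / ρ))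
    (t := 4 * M * K ^ n) (ENNReal.mul_ne_top (ENNReal.mul_ne_top (by simp) (by simp))
      (ENNReal.pow_ne_top hKt)) (hc.trans_eq (by push_cast; ring))
  refine ⟨c, S, hScard, fun T hT m hm top htop => ?_⟩
  have hlm : ∀ b, Measurable fun y => (W.lik (c b) y : ℝ≥0∞) := fun b =>
    (W.measurable_lik (c b)).coe_nnreal_ennreal
  have hsq : ∀ b y, ENNReal.ofReal (√((W.lik (c m) y : ℝ) * W.lik (c b) y))
      = ((W.lik (c m) y : ℝ≥0∞) * (W.lik (c b) y : ℝ≥0∞)) ^ (1 / 2 : ℝ) := by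
    intro b y
    rw [Real.sqrt_eq_rpow, ← ENNReal.ofReal_rpow_of_nonneg (by positivity) (by norm_num),
      ENNReal.ofReal_mul (by positivity), ENNReal.ofReal_coe_nnreal, ENNReal.ofReal_coe_nnreal]
  calc _ ≤ ∫⁻ y, (ENNReal.ofReal (Real.exp (-T)) * (W.lik (c m) y : ℝ≥0∞)
        + 2 * ∑ b ∈ S.erase m,
          ((W.lik (c m) y : ℝ≥0∞) * (W.lik (c b) y : ℝ≥0∞)) ^ (1 / 2 : ℝ)) ∂W.refBlock n := by
        refine lintegral_mono fun y => ?_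
        simp_rw [← hsq]
        rw [← ENNReal.ofReal_sum_of_nonneg fun b _ => Real.sqrt_nonneg _,
          ← ENNReal.ofReal_coe_nnreal, ← ENNReal.ofReal_mul (Real.exp_pos _).le,
          show (2 : ℝ≥0∞) = ENNReal.ofReal 2 by simp, ← ENNReal.ofReal_mul (by norm_num),
          ← ENNReal.ofReal_add (by positivity)
            (mul_nonneg (by norm_num) (Finset.sum_nonneg fun b _ => Real.sqrt_nonneg _)),
          mul_comm (Real.exp (-T))]
        exact ENNReal.ofReal_le_ofReal (mul_exp_signedTrust_le_sum_sqrt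
          (p := fun b => (W.lik (c b) y : ℝ)) (fun b => NNReal.coe_nonneg _) hT
          (htop y).1 hm (htop y).2)
    _ = ENNReal.ofReal (Real.exp (-T)) + 2 * ∑ b ∈ S.erase m, W.bhattacharyya (c m) (c b) := by
        have hm' : ∀ b, Measurable fun y =>
            ((W.lik (c m) y : ℝ≥0∞) * (W.lik (c b) y : ℝ≥0∞)) ^ (1 / 2 : ℝ) := fun b =>
          ((hlm m).mul (hlm b)).pow_const _
        rw [lintegral_add_left ((hlm m).const_mul _), lintegral_const_mul _ (hlm m),
          lintegral_const_mul _ (Finset.measurable_sum _ fun b _ => hm' b),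
          lintegral_finsetSum _ fun b _ => hm' b, lintegral_lik, mul_one]
        rfl
    _ ≤ _ := by
        gcongr
        have hρ : ∀ z : ℝ≥0∞, (z ^ (1 / ρ)) ^ ρ = z := fun z => by
          rw [← ENNReal.rpow_mul, one_div, inv_mul_cancel₀ h0.ne', ENNReal.rpow_one]
        rw [← hρ (∑ b ∈ S.erase m, W.bhattacharyya (c m) (c b))]
        refine ENNReal.rpow_le_rpow ?_ h0.le
        refine (rpow_sum_le_sum_rpow _ _ (by positivity)
          ((div_le_one h0).2 h1)).trans (le_trans ?_ (hS m hm))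
        exact Finset.sum_le_sum_of_subset (Finset.erase_subset_erase _ (Finset.subset_univ _))

end MemorylessChannel

namespace MemorylessChannel

variable {X Y : Type*} [MeasurableSpace X] [MeasurableSpace Y] (W : MemorylessChannel X Y)

/-! ### Inner codes with small exponential moments -/

/-- The exponential moment, at the clipping level `T`, of the signed reliability weight of one
inner decision is at most `2 exp (-T)`, for every inner message and every maximum-likelihood
decoder.  This single condition yields both the error probability of the inner code and the
Chernoff bound for the outer code. -/
def HasMomentBound {n q : ℕ} (enc : Fin q → Fin n → X) (T : ℝ) : Prop :=
  ∀ dec, W.IsMLDecoder enc dec → ∀ a,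
    ∫⁻ y, ENNReal.ofReal (Real.exp (-(T * (W.reliability enc T dec y *
      (if a = dec y then 1 else -1))))) ∂W.blockLaw (enc a) ≤ ENNReal.ofReal (2 * Real.exp (-T))

lemma trust_orderEmbOfFin {n N M : ℕ} (c : Fin N → Fin n → X) {S : Finset (Fin N)}
    (hS : S.card = M) (T : ℝ) (dec : (Fin n → Y) → Fin M) (y : Fin n → Y) :
    trust (fun b => (W.lik (c b) y : ℝ)) S T (S.orderEmbOfFin hS (dec y))
      = W.reliability (fun a => c (S.orderEmbOfFin hS a)) T dec y := by
  have h1 : ∑ b ∈ S.erase (S.orderEmbOfFin hS (dec y)), (W.lik (c b) y : ℝ)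
      = ((∑ a ∈ Finset.univ.erase (dec y), W.lik (c (S.orderEmbOfFin hS a)) y : ℝ≥0) : ℝ) := by
    have h2 : S.erase (S.orderEmbOfFin hS (dec y))
        = (Finset.univ.erase (dec y)).map (S.orderEmbOfFin hS).toEmbedding := by
      rw [Finset.map_erase, Finset.map_orderEmbOfFin_univ]
      rfl
    rw [h2, Finset.sum_map]
    push_cast
    rfl
  unfold trust reliability
  simp only [h1, NNReal.coe_eq_zero]

/-- Passing from a subset `S` of a list of words to a code with messages `Fin M`. -/
lemma hasMomentBound_of_subcode {n N M : ℕ} (c : Fin N → Fin n → X) {S : Finset (Fin N)}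
    (hS : S.card = M) {T : ℝ}
    (h : ∀ m ∈ S, ∀ top : (Fin n → Y) → Fin N,
      (∀ y, top y ∈ S ∧ ∀ b ∈ S, (W.lik (c b) y : ℝ) ≤ W.lik (c (top y)) y) →
      ∫⁻ y, ENNReal.ofReal (W.lik (c m) y *
        Real.exp (-(T * signedTrust (fun b => (W.lik (c b) y : ℝ)) S T (top y) m))) ∂W.refBlock n
      ≤ ENNReal.ofReal (2 * Real.exp (-T))) :
    W.HasMomentBound (fun a => c (S.orderEmbOfFin hS a)) T := by
  intro dec hdec a
  rw [lintegral_blockLaw]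
  refine le_trans (le_of_eq (lintegral_congr fun y => ?_)) (h (S.orderEmbOfFin hS a)
    (Finset.orderEmbOfFin_mem S hS a) (fun y => S.orderEmbOfFin hS (dec y)) fun y =>
      ⟨Finset.orderEmbOfFin_mem S hS _, fun b hb => ?_⟩)
  · rw [ENNReal.ofReal_mul (NNReal.coe_nonneg _), ENNReal.ofReal_coe_nnreal, signedTrust,
      trust_orderEmbOfFin]
    simp only [EmbeddingLike.apply_eq_iff_eq]
  · have hb' : b ∈ Set.range (S.orderEmbOfFin hS) := by
      rw [Finset.range_orderEmbOfFin]; exact hb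
    obtain ⟨a', rfl⟩ := hb'
    exact NNReal.coe_le_coe.2 (hdec.2 y a')

lemma natCast_eq_exp_mul {M n : ℕ} (hM : 0 < M) (hn : 0 < n) :
    (M : ℝ) = Real.exp (n * (Real.log M / n)) := by
  have hn' : (n : ℝ) ≠ 0 := by exact_mod_cast hn.ne'
  rw [mul_div_cancel₀ _ hn', Real.exp_log (by exact_mod_cast hM)]

lemma eventually_le_natCast_mul {γ : ℝ} (hγ : 0 < γ) (b : ℝ) :
    ∀ᶠ n : ℕ in atTop, b ≤ n * γ :=
  (tendsto_natCast_atTop_atTop.atTop_mul_const hγ).eventually_ge_atTop b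

lemma const_mul_exp_le {n : ℕ} {b x t : ℝ} (hb : 0 < b) (h : Real.log b ≤ n * (-t - x)) :
    b * Real.exp (n * x) ≤ Real.exp (-(n * t)) := by
  rw [← Real.exp_log hb, ← Real.exp_add]
  exact Real.exp_le_exp.2 (by linarith)

/-- Codes in the expurgated range of exponents. -/
lemma eventually_exists_hasMomentBound_of_lt_Ex (p : ProbabilityMeasure X) {ρ r t : ℝ}
    (hρ : 1 ≤ ρ) (hr : 0 < r) (ht : 0 < t) (h : t < -ρ * r + W.Ex p ρ) {q : ℕ → ℕ}
    (hq : Tendsto (fun n : ℕ => Real.log (q n) / n) atTop (𝓝 r)) :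
    ∀ᶠ n : ℕ in atTop, ∃ enc : Fin (q n) → Fin n → X, W.HasMomentBound enc (n * t) := by
  have hρ0 : 0 < ρ := by linarith
  set γ := -ρ * r + W.Ex p ρ - t with hγ
  have hγ0 : 0 < γ := by linarith
  filter_upwards [hq.eventually (lt_mem_nhds hr),
    hq.eventually (gt_mem_nhds (show r < r + γ / (2 * ρ) by
      linarith [div_pos hγ0 (mul_pos two_pos hρ0)])),
    eventually_gt_atTop 0, eventually_le_natCast_mul (half_pos hγ0) (Real.log (2 * 4 ^ ρ))]
    with n hL0 hL1 hn hbig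
  set L := Real.log (q n) / n with hL
  have hM : 0 < q n := by
    rcases Nat.eq_zero_or_pos (q n) with h0 | h0
    · rw [hL, h0] at hL0; simp at hL0
    · exact h0
  have hn' : (0 : ℝ) < n := by exact_mod_cast hn
  have hML := natCast_eq_exp_mul hM hn
  rw [← hL] at hML
  obtain ⟨c, S, hS, hc⟩ := W.exists_subcode_of_expurgation p hρ n (q n)
  refine ⟨_, W.hasMomentBound_of_subcode c hS fun m hm top htop =>
    (hc (n * t) (by positivity) m hm top htop).trans ?_⟩
  have h1 : (4 * (q n : ℝ≥0∞) * W.expurgatedIntegral p ρ ^ n) ^ ρ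
      ≤ ENNReal.ofReal (4 ^ ρ * Real.exp (n * (ρ * L - W.Ex p ρ))) := by
    calc (4 * (q n : ℝ≥0∞) * W.expurgatedIntegral p ρ ^ n) ^ ρ
        = (4 * (q n : ℝ≥0∞)) ^ ρ * (W.expurgatedIntegral p ρ ^ ρ) ^ n := by
          rw [ENNReal.mul_rpow_of_nonneg _ _ hρ0.le, ← ENNReal.rpow_natCast,
            ← ENNReal.rpow_natCast, ← ENNReal.rpow_mul, ← ENNReal.rpow_mul, mul_comm ρ]
      _ ≤ (ENNReal.ofReal (4 * Real.exp (n * L))) ^ ρ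
            * ENNReal.ofReal (Real.exp (-W.Ex p ρ)) ^ n := by
          gcongr
          · rw [ENNReal.ofReal_mul (by norm_num), ← hML, ENNReal.ofReal_natCast]
            simp
          · exact W.expurgatedIntegral_rpow_le_exp p hρ0.le
      _ = _ := by
          rw [ENNReal.ofReal_rpow_of_pos (by positivity), ← ENNReal.ofReal_pow (Real.exp_pos _).le,
            ← ENNReal.ofReal_mul (by positivity), Real.mul_rpow (by norm_num) (Real.exp_pos _).le,
            ← Real.exp_mul, ← Real.exp_nat_mul, mul_assoc, ← Real.exp_add]
          congr 3; ring
  have h2 : 2 * 4 ^ ρ * Real.exp (n * (ρ * L - W.Ex p ρ)) ≤ Real.exp (-(n * t)) := by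
    refine const_mul_exp_le (by positivity) (hbig.trans ?_)
    refine mul_le_mul_of_nonneg_left ?_ hn'.le
    have h3 : ρ * L ≤ ρ * r + γ / 2 := by
      calc ρ * L ≤ ρ * (r + γ / (2 * ρ)) := by gcongr
        _ = _ := by field_simp
    linarith
  calc _ ≤ ENNReal.ofReal (Real.exp (-(n * t)))
        + 2 * ENNReal.ofReal (4 ^ ρ * Real.exp (n * (ρ * L - W.Ex p ρ))) := by gcongr
    _ = ENNReal.ofReal (Real.exp (-(n * t)) + 2 * (4 ^ ρ * Real.exp (n * (ρ * L - W.Ex p ρ)))) := by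
        rw [show (2 : ℝ≥0∞) = ENNReal.ofReal 2 by simp, ← ENNReal.ofReal_mul (by norm_num),
          ← ENNReal.ofReal_add (Real.exp_pos _).le (by positivity)]
    _ ≤ _ := ENNReal.ofReal_le_ofReal (by linarith)

/-- Codes in the random-coding range of exponents.  The list contains `D ≈ M exp (-ε n)`
superfluous words, and the trimming order `i` is so large that `exp (-ε n i)` beats every other
exponential factor. -/
lemma eventually_exists_hasMomentBound_of_lt_E0 (p : ProbabilityMeasure X) {ρ r t : ℝ}
    (hρ0 : 0 ≤ ρ) (hρ1 : ρ ≤ 1) (hr : 0 < r) (ht : 0 < t) (h : t < -ρ * r + W.E0 p ρ)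
    {q : ℕ → ℕ} (hq : Tendsto (fun n : ℕ => Real.log (q n) / n) atTop (𝓝 r)) :
    ∀ᶠ n : ℕ in atTop, ∃ enc : Fin (q n) → Fin n → X, W.HasMomentBound enc (n * t) := by
  set γ := -ρ * r + W.E0 p ρ - t with hγ
  have hγ0 : 0 < γ := by linarith
  -- `ε ≤ r / 2` keeps `M exp (-ε n) ≥ 1`, and `ε ≤ γ / 4` limits the loss in the exponent caused by
  -- dividing the total confusion by `D` instead of `M`.
  set ε := min (γ / 4) (r / 2) with hε
  have hε0 : 0 < ε := lt_min (by linarith) (by linarith)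
  have hεγ : ε ≤ γ / 4 := min_le_left _ _
  have hεr : ε ≤ r / 2 := min_le_right _ _
  obtain ⟨i, hi⟩ := exists_nat_ge ((2 * t + 2 * r + 4) / ε)
  rw [div_le_iff₀ hε0] at hi
  filter_upwards [hq.eventually (lt_mem_nhds (show r / 2 < r by linarith)),
    hq.eventually (gt_mem_nhds (show r < r + γ / 4 by linarith)),
    hq.eventually (gt_mem_nhds (show r < r + 1 by linarith)),
    eventually_gt_atTop 0,
    eventually_le_natCast_mul (half_pos hγ0) (Real.log (32 * (i + 1))),
    eventually_le_natCast_mul two_pos (Real.log (2 * (4 * 4 ^ i)))]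
    with n hL0 hL1 hL2 hn hbig1 hbig2
  set L := Real.log (q n) / n with hL
  set M := q n with hMdef
  have hM : 0 < M := by
    rcases Nat.eq_zero_or_pos M with h0 | h0
    · rw [hL, h0] at hL0; simp at hL0; linarith
    · exact h0
  have hn' : (0 : ℝ) < n := by exact_mod_cast hn
  have hM' : (0 : ℝ) < M := by exact_mod_cast hM
  have hML := natCast_eq_exp_mul hM hn
  rw [← hL] at hML
  set θ := Real.exp (-(n * ε)) with hθ
  have hθ0 : 0 < θ := Real.exp_pos _
  have hθ1 : θ ≤ 1 := Real.exp_le_one_iff.2 (by nlinarith)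
  have hMθ : 1 ≤ M * θ := by
    rw [hML, hθ, ← Real.exp_add]
    exact Real.one_le_exp (by nlinarith)
  set D := ⌈M * θ⌉₊ with hDdef
  have hD : 0 < D := Nat.ceil_pos.2 (by linarith)
  have hD' : (0 : ℝ) < D := by exact_mod_cast hD
  have hDge : M * θ ≤ D := Nat.le_ceil _
  have hDle : (D : ℝ) ≤ 2 * (M * θ) := by
    have := Nat.ceil_lt_add_one (a := M * θ) (by positivity)
    rw [← hDdef] at this; linarith
  have hDM : (D : ℝ) ≤ M := by
    have : D ≤ M := Nat.ceil_le.2 (by nlinarith)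
    exact_mod_cast this
  obtain ⟨c, hc⟩ := W.exists_list_confusion_le p hρ0 hρ1 n (M + D)
  set G := (2 * (M : ℝ)) * ((2 * M) ^ ρ * Real.exp (-(n * W.E0 p ρ))) with hG
  have hG0 : 0 < G := by positivity
  have hcG : (((M + D : ℕ) : ℝ≥0∞)) * (((M + D : ℕ) : ℝ≥0∞) ^ ρ * W.gallagerIntegral p ρ ^ n)
      ≤ ENNReal.ofReal G := by
    have h1 : ((M + D : ℕ) : ℝ≥0∞) ≤ ENNReal.ofReal (2 * M) := by
      rw [← ENNReal.ofReal_natCast]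
      refine ENNReal.ofReal_le_ofReal ?_
      push_cast; linarith
    have h2 : W.gallagerIntegral p ρ ^ n ≤ ENNReal.ofReal (Real.exp (-(n * W.E0 p ρ))) := by
      refine (pow_le_pow_left₀ zero_le (W.gallagerIntegral_le_exp p hρ0) n).trans_eq ?_
      rw [← ENNReal.ofReal_pow (Real.exp_pos _).le, ← Real.exp_nat_mul]
      congr 2; ring
    rw [hG, ENNReal.ofReal_mul (by positivity : (0 : ℝ) ≤ 2 * M),
      ENNReal.ofReal_mul (by positivity : (0 : ℝ) ≤ (2 * M) ^ ρ),
      ← ENNReal.ofReal_rpow_of_pos (by positivity : (0 : ℝ) < 2 * M)]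
    gcongr
  obtain ⟨S, hS, hSc⟩ := exists_subcode_of_confusion (W.refBlock n) hM hD
    (p := fun b y => (W.lik (c b) y : ℝ)) (fun b => (W.measurable_lik (c b)).coe_nnreal_real)
    (fun b y => NNReal.coe_nonneg _)
    (fun b => by simp_rw [ENNReal.ofReal_coe_nnreal]; exact (W.lintegral_lik _).le) hG0
    (hc.trans hcG) i
  refine ⟨_, W.hasMomentBound_of_subcode c hS fun m hm top htop =>
    (hSc (n * t) (by positivity) m hm top htop).trans (ENNReal.ofReal_le_ofReal ?_)⟩
  have h1 : 4 * ((i + 1) * G / D) ≤ 1 / 2 * Real.exp (-(n * t)) := by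
    have h2 : G / D ≤ 4 * Real.exp (n * (ρ * L + ε - W.E0 p ρ)) := by
      rw [div_le_iff₀ hD']
      calc G ≤ (2 * (M : ℝ)) * ((2 * M ^ ρ) * Real.exp (-(n * W.E0 p ρ))) := by
            rw [hG, Real.mul_rpow (by norm_num) hM'.le]
            gcongr
            calc (2 : ℝ) ^ ρ ≤ 2 ^ (1 : ℝ) :=
                  Real.rpow_le_rpow_of_exponent_le (by norm_num) hρ1
              _ = 2 := Real.rpow_one 2
        _ = 4 * Real.exp (n * (ρ * L + ε - W.E0 p ρ)) * (M * θ) := by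
            have h3 : (M : ℝ) ^ ρ = Real.exp (n * (ρ * L)) := by
              rw [hML, ← Real.exp_mul]; congr 1; ring
            have h4 : Real.exp (n * (ρ * L + ε - W.E0 p ρ))
                = Real.exp (n * (ρ * L)) * Real.exp (-(n * W.E0 p ρ)) * Real.exp (n * ε) := by
              rw [← Real.exp_add, ← Real.exp_add]; congr 1; ring
            have h5 : Real.exp (n * ε) * θ = 1 := by
              rw [hθ, ← Real.exp_add]; simp
            rw [h3, h4]
            linear_combination (-4 * M * Real.exp (n * (ρ * L)) *
              Real.exp (-(n * W.E0 p ρ))) * h5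
        _ ≤ _ := by gcongr
    have h3 : 32 * ((i : ℝ) + 1) * Real.exp (n * (ρ * L + ε - W.E0 p ρ)) ≤ Real.exp (-(n * t)) := by
      refine const_mul_exp_le (by positivity) (hbig1.trans ?_)
      refine mul_le_mul_of_nonneg_left ?_ hn'.le
      have h6 : ρ * L ≤ ρ * r + γ / 4 := by nlinarith
      linarith
    have h4 : 4 * ((i + 1) * G / D) = 4 * (i + 1) * (G / D) := by ring
    rw [h4]
    have h5 := mul_le_mul_of_nonneg_left h2 (by positivity : (0 : ℝ) ≤ 4 * (i + 1))
    linarith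
  have h2 : Real.exp (n * t) * ((M + D) ^ 2 * (2 * (D / M)) ^ i) ≤ 1 / 2 * Real.exp (-(n * t)) := by
    have h3 : (D : ℝ) / M ≤ 2 * θ := by
      rw [div_le_iff₀ hM']; linarith
    have h4 : Real.exp (n * t) * ((M + D) ^ 2 * (2 * (D / M)) ^ i)
        ≤ Real.exp (n * t) * ((2 * M) ^ 2 * (2 * (2 * θ)) ^ i) := by
      gcongr
      linarith
    have h5 : Real.exp (n * t) * ((2 * (M : ℝ)) ^ 2 * (2 * (2 * θ)) ^ i)
        = 4 * 4 ^ i * Real.exp (n * (t + 2 * L - ε * i)) := by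
      rw [show (2 : ℝ) * (2 * θ) = 4 * θ by ring, mul_pow, mul_pow, hML, hθ, ← Real.exp_nat_mul,
        ← Real.exp_nat_mul, show (n : ℝ) * (t + 2 * L - ε * i)
          = n * t + (2 : ℕ) * (n * L) + i * (-(n * ε)) by push_cast; ring, Real.exp_add,
        Real.exp_add]
      ring
    have h6 : 2 * (4 * 4 ^ i) * Real.exp (n * (t + 2 * L - ε * i)) ≤ Real.exp (-(n * t)) := by
      refine const_mul_exp_le (by positivity) (hbig2.trans ?_)
      refine mul_le_mul_of_nonneg_left ?_ hn'.le
      linarith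
    linarith
  linarith

end MemorylessChannel

/-! ### Diagonal selection -/

/-- If all values below `V` are eventually exceeded by elements of `A i`, while `A i` stays at or
below `V`, then a selection of near-maximal elements converges to `V`. -/
lemma exists_tendsto_of_eventually_exists_ge {I : Type*} {l : Filter I} {δ : I → ℝ}
    (hδ : Tendsto δ l (𝓝[>] 0)) {A : I → Set ℝ} {V : EReal} (hne : ∀ i, (A i).Nonempty)
    (hle : ∀ i, ∀ a ∈ A i, (a : EReal) ≤ V)
    (hmem : ∀ a : ℝ, (a : EReal) < V → ∀ᶠ i in l, ∃ b ∈ A i, a ≤ b) :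
    ∃ e : I → ℝ, (∀ i, e i ∈ A i) ∧ Tendsto (fun i => (e i : EReal)) l (𝓝 V) := by
  have hsel : ∀ i, ∃ e ∈ A i, 0 < δ i → ∀ b ∈ A i, b ≤ e + δ i ∨ 1 / δ i ≤ e := by
    intro i
    by_cases hpos : 0 < δ i
    · by_cases hb : BddAbove (A i)
      · obtain ⟨e, he, hlt⟩ := exists_lt_of_lt_csSup (hne i) (sub_lt_self (sSup (A i)) hpos)
        exact ⟨e, he, fun _ b hbA => Or.inl (by linarith [le_csSup hb hbA])⟩
      · rw [not_bddAbove_iff] at hb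
        obtain ⟨e, he, hlt⟩ := hb (1 / δ i)
        exact ⟨e, he, fun _ b _ => Or.inr hlt.le⟩
    · obtain ⟨e, he⟩ := hne i
      exact ⟨e, he, fun h => absurd h hpos⟩
  choose e he hsel using hsel
  refine ⟨e, he, tendsto_order.2 ⟨fun b hb => ?_, fun b hb => ?_⟩⟩
  · obtain ⟨a, hba, haV⟩ := EReal.lt_iff_exists_real_btwn.1 hb
    obtain ⟨a', haa', ha'V⟩ := EReal.lt_iff_exists_real_btwn.1 haV
    have haa : a < a' := EReal.coe_lt_coe_iff.1 haa'
    have hδ0 : ∀ᶠ i in l, 0 < δ i := hδ.eventually self_mem_nhdsWithin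
    have hδ1 : ∀ᶠ i in l, δ i < a' - a :=
      (hδ.mono_right nhdsWithin_le_nhds).eventually (gt_mem_nhds (by linarith))
    have hδ2 : ∀ᶠ i in l, a < 1 / δ i := by
      simp_rw [one_div]
      exact (tendsto_inv_nhdsGT_zero.comp hδ).eventually (eventually_gt_atTop a)
    filter_upwards [hmem a' ha'V, hδ0, hδ1, hδ2] with i ⟨c, hc, hac⟩ h0 h1 h2
    refine hba.trans (EReal.coe_lt_coe_iff.2 ?_)
    rcases hsel i h0 c hc with h | h <;> linarith
  · exact Eventually.of_forall fun i => (hle i _ (he i)).trans_lt hb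

namespace MemorylessChannel

variable {X Y : Type*} [MeasurableSpace X] [MeasurableSpace Y] (W : MemorylessChannel X Y)

/-! ### Gallager's exponent -/

lemma nonempty_of_capacity_pos (h : 0 < W.capacity) : Nonempty X := by
  by_contra hX
  rw [not_nonempty_iff] at hX
  have : IsEmpty (ProbabilityMeasure X) := ⟨fun p => by
    have h1 := measure_univ (μ := (p : Measure X))
    rw [Set.univ_eq_empty_iff.2 hX, measure_empty] at h1
    exact zero_ne_one h1⟩
  rw [capacity, iSup_of_empty] at h
  exact lt_irrefl _ h

/-- A deterministic input shows that the exponent is nonnegative. -/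
lemma gallagerExponent_nonneg [Nonempty X] {R : ℝ} (hR : 0 < R) : 0 ≤ W.gallagerExponent R := by
  obtain ⟨x⟩ := ‹Nonempty X›
  let p : ProbabilityMeasure X := ⟨Measure.dirac x, inferInstance⟩
  have hp : (p : Measure X) = Measure.dirac x := rfl
  have hE0 : ∀ ρ ∈ Icc (0 : ℝ) 1, W.E0 p ρ = 0 := by
    intro ρ hρ
    have hρ' : 1 + ρ ≠ 0 := by linarith [hρ.1]
    have h1 : ∀ y, ∫⁻ x, (W.w x y : ℝ≥0∞) ^ (1 / (1 + ρ)) ∂(p : Measure X)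
        = (W.w x y : ℝ≥0∞) ^ (1 / (1 + ρ)) := fun y => by
      rw [hp, lintegral_dirac' _ ((W.measurable_w_left y).coe_nnreal_ennreal.pow_const _)]
    simp_rw [E0, h1, ← ENNReal.rpow_mul, one_div, inv_mul_cancel₀ hρ', ENNReal.rpow_one,
      W.lintegral_w]
    simp
  have hEx : ∀ ρ, W.Ex p ρ = 0 := by
    intro ρ
    have hl : ∀ s : ℝ, Measurable fun z : X × X => W.letterBhattacharyya z.1 z.2 ^ s := fun s =>
      W.measurable_letterBhattacharyya.pow_const s
    have h1 : ∫⁻ x, ∫⁻ x', W.letterBhattacharyya x x' ^ (1 / ρ) ∂(p : Measure X) ∂(p : Measure X)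
        = 1 := by
      have hl2 : Measurable fun x' => W.letterBhattacharyya x x' ^ (1 / ρ) :=
        (hl (1 / ρ)).comp (f := fun x' => (x, x')) (measurable_const.prodMk measurable_id)
      rw [hp, lintegral_dirac' _ (hl _).lintegral_prod_right']
      change ∫⁻ x', W.letterBhattacharyya x x' ^ (1 / ρ) ∂Measure.dirac x = 1
      rw [lintegral_dirac' _ hl2]
      have h2 : W.letterBhattacharyya x x = 1 := by
        rw [letterBhattacharyya, ← W.lintegral_w x]
        refine lintegral_congr fun y => ?_
        rw [← sq, ← ENNReal.rpow_natCast, ← ENNReal.rpow_mul]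
        norm_num
      rw [h2, ENNReal.one_rpow]
    unfold letterBhattacharyya at h1
    rw [Ex, h1]
    simp
  have hRx : W.Rx p = 0 := by
    have : W.Ex p = fun _ => 0 := funext hEx
    rw [Rx, this]
    simp
  have hRc : W.Rcrit p = 0 := by
    rw [Rcrit, derivWithin_congr (f := fun _ => 0) hE0 (hE0 1 ⟨zero_le_one, le_rfl⟩)]
    simp
  refine le_trans ?_ (le_iSup (fun p => W.EL R p) p)
  rw [EL, hRx, hRc, if_neg (not_le.2 hR), if_neg (not_le.2 hR)]
  refine le_trans (le_of_eq ?_) (le_iSup₂ (f := fun ρ (_ : ρ ∈ Icc (0 : ℝ) 1) =>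
    ((-ρ * R + W.E0 p ρ : ℝ) : EReal)) 0 ⟨le_rfl, zero_le_one⟩)
  rw [hE0 0 ⟨le_rfl, zero_le_one⟩]
  simp

/-- Below Gallager's exponent, inner codes with small exponential moments exist. -/
lemma eventually_exists_hasMomentBound {r t : ℝ} (hr : 0 < r) (ht : 0 < t)
    (h : (t : EReal) < W.gallagerExponent r) {q : ℕ → ℕ}
    (hq : Tendsto (fun n : ℕ => Real.log (q n) / n) atTop (𝓝 r)) :
    ∀ᶠ n : ℕ in atTop, ∃ enc : Fin (q n) → Fin n → X, W.HasMomentBound enc (n * t) := by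
  obtain ⟨p, hp⟩ := lt_iSup_iff.1 h
  rw [EL] at hp
  split_ifs at hp
  · obtain ⟨ρ, hp⟩ := lt_iSup_iff.1 hp
    obtain ⟨hρ, hp⟩ := lt_iSup_iff.1 hp
    exact W.eventually_exists_hasMomentBound_of_lt_Ex p hρ hr ht (EReal.coe_lt_coe_iff.1 hp) hq
  · have h1 := EReal.coe_lt_coe_iff.1 hp
    exact W.eventually_exists_hasMomentBound_of_lt_E0 p zero_le_one le_rfl hr ht (by linarith) hq
  · obtain ⟨ρ, hp⟩ := lt_iSup_iff.1 hp
    obtain ⟨hρ, hp⟩ := lt_iSup_iff.1 hp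
    exact W.eventually_exists_hasMomentBound_of_lt_E0 p hρ.1 hρ.2 hr ht
      (EReal.coe_lt_coe_iff.1 hp) hq

/-! ### The exponential moment controls both error events -/

lemma reliability_nonneg {n q : ℕ} (enc : Fin q → Fin n → X) (T : ℝ)
    (dec : (Fin n → Y) → Fin q) (y : Fin n → Y) : 0 ≤ W.reliability enc T dec y := by
  unfold reliability
  simp only
  split_ifs
  exacts [zero_le_one, le_max_left _ _]

lemma reliability_le_one {n q : ℕ} (enc : Fin q → Fin n → X) (T : ℝ)
    (dec : (Fin n → Y) → Fin q) (y : Fin n → Y) : W.reliability enc T dec y ≤ 1 := by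
  unfold reliability
  simp only
  split_ifs
  exacts [le_rfl, max_le zero_le_one (min_le_left _ _)]

lemma measurable_reliability {n q : ℕ} (enc : Fin q → Fin n → X) (T : ℝ)
    {dec : (Fin n → Y) → Fin q} (hdec : Measurable dec) :
    Measurable (W.reliability enc T dec) := by
  classical
  set h : Fin q × (Fin n → Y) → ℝ := fun z =>
    if ∑ a ∈ Finset.univ.erase z.1, W.lik (enc a) z.2 = 0 then 1
    else max 0 (min 1 (Real.log ((W.lik (enc z.1) z.2 : ℝ) /
      (∑ a ∈ Finset.univ.erase z.1, W.lik (enc a) z.2 : ℝ≥0)) / (2 * T))) with hh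
  have hm : Measurable h := by
    refine measurable_from_prod_countable_right fun a => ?_
    have h1 : Measurable fun y => ∑ b ∈ Finset.univ.erase a, W.lik (enc b) y :=
      Finset.measurable_sum _ fun b _ => W.measurable_lik (enc b)
    refine Measurable.ite (h1 (measurableSet_singleton 0)) measurable_const ?_
    exact measurable_const.max (measurable_const.min
      (((W.measurable_lik (enc a)).coe_nnreal_real.div h1.coe_nnreal_real).log.div_const _))
  have he : W.reliability enc T dec = fun y => h (dec y, y) := by
    ext y
    simp only [reliability, hh]
  rw [he]
  exact hm.comp (hdec.prodMk measurable_id)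

lemma measurable_exp_moment {n q : ℕ} (enc : Fin q → Fin n → X) (T : ℝ)
    {dec : (Fin n → Y) → Fin q} (hdec : Measurable dec) (a : Fin q) :
    Measurable fun y => ENNReal.ofReal (Real.exp (-(T * (W.reliability enc T dec y *
      (if a = dec y then 1 else -1))))) := by
  have h1 : Measurable fun y => if a = dec y then (1 : ℝ) else -1 :=
    (measurable_of_countable fun b => if a = b then (1 : ℝ) else -1).comp hdec
  exact (((W.measurable_reliability enc T hdec).mul h1).const_mul T).neg.exp.ennreal_ofReal

/-- A wrong decision has nonpositive signed weight, so the moment bounds the error probability. -/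
lemma HasMomentBound.blockLaw_ne_le {W : MemorylessChannel X Y} {n q : ℕ}
    {enc : Fin q → Fin n → X} {T : ℝ}
    (h : W.HasMomentBound enc T) (hT : 0 < T) {dec : (Fin n → Y) → Fin q}
    (hdec : W.IsMLDecoder enc dec) (a : Fin q) :
    W.blockLaw (enc a) {y | dec y ≠ a} ≤ ENNReal.ofReal (2 * Real.exp (-T)) := by
  refine le_trans ?_ (h dec hdec a)
  have h1 := mul_meas_ge_le_lintegral (μ := W.blockLaw (enc a))
    (W.measurable_exp_moment enc T hdec.1 a) 1
  rw [one_mul] at h1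
  refine (measure_mono fun y hy => ?_).trans h1
  have hy' : ¬ a = dec y := fun e => hy e.symm
  simp only [Set.mem_ofPred_eq, if_neg hy']
  rw [ENNReal.one_le_ofReal]
  refine Real.one_le_exp ?_
  have := mul_nonneg hT.le (W.reliability_nonneg enc T dec y)
  linarith

/-- The Chernoff bound, at the parameter `T`, for the soft agreement with the transmitted outer
codeword. -/
lemma HasMomentBound.concatLaw_gmdDot_le {W : MemorylessChannel X Y} {n q N : ℕ}
    {enc : Fin q → Fin n → X} {T : ℝ} (h : W.HasMomentBound enc T) (hT : 0 < T)
    {dec : (Fin n → Y) → Fin q} (hdec : W.IsMLDecoder enc dec) (x : Fin N → Fin q) (s : ℝ) :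
    concatLaw W enc x {y | gmdDot (fun i => W.reliability enc T dec (y i)) (fun i => dec (y i)) x
        ≤ N * s} ≤ ENNReal.ofReal (Real.exp (N * (Real.log 2 - T * (1 - s)))) := by
  set f : Fin q → (Fin n → Y) → ℝ≥0∞ := fun a y => ENNReal.ofReal (Real.exp (-(T *
    (W.reliability enc T dec y * (if a = dec y then 1 else -1))))) with hf
  have hfm : ∀ a, Measurable (f a) := fun a => W.measurable_exp_moment enc T hdec.1 a
  have hPm : Measurable fun y : Fin N → Fin n → Y => ∏ i, f (x i) (y i) :=
    Finset.measurable_prod _ fun i _ => (hfm (x i)).comp (measurable_pi_apply i)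
  have hFm : Measurable fun y : Fin N → Fin n → Y =>
      ENNReal.ofReal (Real.exp (T * (N * s))) * ∏ i, f (x i) (y i) := hPm.const_mul _
  have h1 := mul_meas_ge_le_lintegral (μ := concatLaw W enc x) hFm 1
  rw [one_mul] at h1
  refine (measure_mono fun y hy => ?_).trans (h1.trans ?_)
  · have hy' : gmdDot (fun i => W.reliability enc T dec (y i)) (fun i => dec (y i)) x ≤ N * s := hy
    simp only [Set.mem_ofPred_eq, hf]
    rw [← ENNReal.ofReal_prod_of_nonneg fun i _ => (Real.exp_pos _).le, ← Real.exp_sum,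
      ← ENNReal.ofReal_mul (Real.exp_pos _).le, ← Real.exp_add, ENNReal.one_le_ofReal]
    refine Real.one_le_exp ?_
    rw [Finset.sum_neg_distrib, ← Finset.mul_sum]
    have h2 : ∑ i, W.reliability enc T dec (y i) * (if x i = dec (y i) then (1 : ℝ) else -1)
        ≤ N * s := by
      refine le_trans (le_of_eq ?_) hy'
      unfold gmdDot
      refine Finset.sum_congr rfl fun i _ => ?_
      split_ifs <;> rfl
    have := mul_le_mul_of_nonneg_left h2 hT.le
    linarith
  · rw [lintegral_const_mul _ hPm, concatLaw,
      lintegral_pi_prod (fun i => W.blockLaw (enc (x i))) (f := fun i => f (x i))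
        fun i => hfm (x i)]
    calc _ ≤ ENNReal.ofReal (Real.exp (T * (N * s))) *
          ∏ i : Fin N, ENNReal.ofReal (2 * Real.exp (-T)) := by
          gcongr with i
          exact h dec hdec (x i)
      _ = _ := by
          rw [Finset.prod_const, Finset.card_univ, Fintype.card_fin,
            ← ENNReal.ofReal_pow (by positivity), ← ENNReal.ofReal_mul (Real.exp_pos _).le]
          congr 1
          have h3 : 2 * Real.exp (-T) = Real.exp (Real.log 2 - T) := by
            rw [Real.exp_sub, Real.exp_log two_pos, Real.exp_neg]; ring
          rw [h3, ← Real.exp_nat_mul, ← Real.exp_add]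
          congr 1; ring

/-! ### Assembling the concatenated code -/

/-- Inner codes that achieve Gallager's exponent, with clipping levels, obtained by letting the
exponent `t` of the moment bound tend to `E(r)` with the block length. -/
lemma exists_innerCode [Nonempty X] {r : ℝ} (hr : 0 < r) {q : ℕ → ℕ}
    (hq : Tendsto (fun n : ℕ => Real.log (q n) / n) atTop (𝓝 r)) :
    ∃ (enc : ∀ n, Fin (q n) → Fin n → X) (T : ℕ → ℝ),
      W.AchievesExponent q enc (W.gallagerExponent r) ∧ (∀ n, 0 < T n) ∧
      Tendsto (fun n : ℕ => ((T n / n : ℝ) : EReal)) atTop (𝓝 (W.gallagerExponent r)) ∧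
      (0 < W.gallagerExponent r → ∀ᶠ n in atTop, W.HasMomentBound (enc n) (T n)) := by
  set E := W.gallagerExponent r with hE
  have hE0 : 0 ≤ E := W.gallagerExponent_nonneg hr
  have hδ : Tendsto (fun n : ℕ => 1 / ((n : ℝ) + 1)) atTop (𝓝[>] 0) :=
    tendsto_nhdsWithin_iff.2 ⟨tendsto_one_div_add_atTop_nhds_zero_nat,
      Eventually.of_forall fun n => by simp only [Set.mem_Ioi]; positivity⟩
  obtain ⟨e, he, heE⟩ := exists_tendsto_of_eventually_exists_ge hδ
    (A := fun n : ℕ => {t : ℝ | (t : EReal) ≤ E ∧ (0 < t →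
      ∃ enc : Fin (q n) → Fin n → X, W.HasMomentBound enc (n * t))}) (V := E)
    (fun n => ⟨0, by simpa using hE0, fun h => absurd h (lt_irrefl _)⟩) (fun n t ht => ht.1)
    (fun a ha => by
      rcases le_or_gt a 0 with h0 | h0
      · exact Eventually.of_forall fun n =>
          ⟨0, ⟨by simpa using hE0, fun h => absurd h (lt_irrefl _)⟩, h0⟩
      · filter_upwards [W.eventually_exists_hasMomentBound hr h0 ha hq] with n hn
        exact ⟨a, ⟨ha.le, fun _ => hn⟩, le_rfl⟩)
  obtain ⟨x₀⟩ := ‹Nonempty X›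
  have hex : ∀ n, ∃ enc : Fin (q n) → Fin n → X, 0 < e n → W.HasMomentBound enc (n * e n) := by
    intro n
    by_cases h : 0 < e n
    · obtain ⟨enc, henc⟩ := (he n).2 h
      exact ⟨enc, fun _ => henc⟩
    · exact ⟨fun _ _ => x₀, fun h' => absurd h' h⟩
  choose enc henc using hex
  set T : ℕ → ℝ := fun n => if 0 < n * e n then n * e n else 1 with hT
  have hTpos : ∀ n, 0 < T n := fun n => by
    simp only [hT]; split_ifs with h; exacts [h, one_pos]
  have hpos : 0 < E → ∀ᶠ n : ℕ in atTop, 0 < n ∧ 0 < e n := fun h => by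
    filter_upwards [heE.eventually (lt_mem_nhds h), eventually_gt_atTop 0] with n hn h0
    exact ⟨h0, by exact_mod_cast hn⟩
  have hTe : ∀ n : ℕ, 0 < n ∧ 0 < e n → T n = n * e n := fun n ⟨h0, h1⟩ => by
    have : (0 : ℝ) < n * e n := mul_pos (by exact_mod_cast h0) h1
    simp only [hT, if_pos this]
  have hmom : 0 < E → ∀ᶠ n in atTop, W.HasMomentBound (enc n) (T n) := fun h => by
    filter_upwards [hpos h] with n hn
    rw [hTe n hn]
    exact henc n hn.2
  have hTlim : Tendsto (fun n : ℕ => ((T n / n : ℝ) : EReal)) atTop (𝓝 E) := by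
    rcases hE0.eq_or_lt with h0 | h0
    · have h1 : ∀ n, T n = 1 := fun n => by
        have h2 : e n ≤ 0 := by
          have := (he n).1
          rw [← h0] at this
          exact_mod_cast this
        have h3 : ¬ (0 : ℝ) < n * e n :=
          not_lt.2 (mul_nonpos_of_nonneg_of_nonpos (Nat.cast_nonneg n) h2)
        simp only [hT, if_neg h3]
      simp_rw [h1]
      rw [← h0]
      exact (continuous_coe_real_ereal.tendsto 0).comp tendsto_one_div_atTop_nhds_zero_nat
    · refine heE.congr' ?_
      filter_upwards [hpos h0] with n hn
      have : (n : ℝ) ≠ 0 := by exact_mod_cast hn.1.ne'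
      rw [hTe n hn, mul_div_cancel_left₀ _ this]
  refine ⟨enc, T, ?_, hTpos, hTlim, hmom⟩
  intro E' hE'
  rcases hE0.eq_or_lt with h0 | h0
  · refine Eventually.of_forall fun n dec _ a => prob_le_one.trans ?_
    rw [← h0] at hE'
    have h1 : E' < 0 := by exact_mod_cast hE'
    rw [ENNReal.one_le_ofReal]
    refine Real.one_le_exp ?_
    have := mul_nonneg (Nat.cast_nonneg (α := ℝ) n) (neg_nonneg.2 h1.le)
    linarith
  obtain ⟨E'', h1, h2⟩ := EReal.lt_iff_exists_real_btwn.1 hE'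
  have h1' : E' < E'' := EReal.coe_lt_coe_iff.1 h1
  filter_upwards [hTlim.eventually (lt_mem_nhds h2), hmom h0, eventually_gt_atTop 0,
    eventually_le_natCast_mul (sub_pos.2 h1') (Real.log 2)] with n hn hm hn0 hbig dec hdec a
  refine (hm.blockLaw_ne_le (hTpos n) hdec a).trans (ENNReal.ofReal_le_ofReal ?_)
  have h3 : E'' < T n / n := EReal.coe_lt_coe_iff.1 hn
  rw [lt_div_iff₀ (by exact_mod_cast hn0)] at h3
  calc 2 * Real.exp (-T n) = Real.exp (Real.log 2 - T n) := by
        rw [Real.exp_sub, Real.exp_log two_pos, Real.exp_neg]; ring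
    _ ≤ _ := Real.exp_le_exp.2 (by nlinarith)

/-- The exponent of the concatenated code, for fixed design parameters. -/
lemma concatenatedBound_of_lt [Nonempty X] {R r ε₁ ε₂ e : ℝ} (hR : 0 < R) (hr : 0 < r)
    (hε₂ : 0 < ε₂) (hK : ∃ K : ℕ, 1 / ε₂ = K)
    (h : e ≤ 0 ∨ ∃ t : ℝ, 0 < t ∧ (t : EReal) < W.gallagerExponent (R / r) ∧
      0 ≤ 1 - (ε₂ / 2 + (r + ε₁) * (1 - ε₂ / 2)) ∧
      e < t * (1 - (ε₂ / 2 + (r + ε₁) * (1 - ε₂ / 2)))) :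
    ConcatenatedBound W R r ε₁ ε₂ e := by
  obtain ⟨K, hK⟩ := hK
  intro q hq
  obtain ⟨enc, T, hach, hTpos, hTlim, hmom⟩ := W.exists_innerCode (div_pos hR hr) hq
  refine ⟨enc, T, hach, hTpos, hTlim, ?_⟩
  set s := ε₂ / 2 + (r + ε₁) * (1 - ε₂ / 2) with hs
  have hev : ∀ᶠ n in atTop, ∀ (dec : (Fin n → Y) → Fin (q n)), W.IsMLDecoder (enc n) dec →
      ∀ (N : ℕ) (x : Fin N → Fin (q n)),
      concatLaw W (enc n) x {y | gmdDot (fun i => W.reliability (enc n) (T n) dec (y i))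
        (fun i => dec (y i)) x ≤ N * s} ≤ ENNReal.ofReal (Real.exp (-((N * n : ℝ) * e))) := by
    rcases h with he | ⟨t, ht, htE, hs0, het⟩
    · refine Eventually.of_forall fun n dec _ N x => ?_
      have : IsProbabilityMeasure (concatLaw W (enc n) x) := by
        unfold concatLaw; infer_instance
      refine prob_le_one.trans ?_
      rw [ENNReal.one_le_ofReal]
      refine Real.one_le_exp ?_
      have : (0 : ℝ) ≤ N * n := by positivity
      nlinarith
    · have hE : 0 < W.gallagerExponent (R / r) :=
        lt_trans (by exact_mod_cast ht) htE
      filter_upwards [hTlim.eventually (lt_mem_nhds htE), hmom hE, eventually_gt_atTop 0,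
        eventually_le_natCast_mul (sub_pos.2 het) (Real.log 2)] with n hn hm hn0 hbig dec hdec N x
      refine (hm.concatLaw_gmdDot_le (hTpos n) hdec x s).trans (ENNReal.ofReal_le_ofReal ?_)
      refine Real.exp_le_exp.2 ?_
      have h3 : t < T n / n := EReal.coe_lt_coe_iff.1 hn
      rw [lt_div_iff₀ (by exact_mod_cast hn0)] at h3
      have h4 : t * n * (1 - s) ≤ T n * (1 - s) := mul_le_mul_of_nonneg_right h3.le hs0
      have h5 : Real.log 2 - T n * (1 - s) ≤ -(n * e) := by linarith
      have := mul_le_mul_of_nonneg_left h5 (Nat.cast_nonneg (α := ℝ) N)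
      linarith
  filter_upwards [hev] with n hn dec hdec N C g hg x
  refine ⟨measure_mono fun y hy => ?_, hn dec hdec N x.1⟩
  by_contra hlt
  exact hy (hg.eq_some hε₂ hK (fun i => W.reliability_nonneg _ _ _ _)
    (fun i => W.reliability_le_one _ _ _ _) (not_le.1 hlt))

lemma eventually_concatenatedBound_of_lt [Nonempty X] {R r a : ℝ} (hR : 0 < R) (hr : 0 < r)
    (hr1 : r ≤ 1) (ha : (a : EReal) < ((1 - r : ℝ) : EReal) * W.gallagerExponent (R / r)) :
    ∀ᶠ ε : ℝ × ℝ in 𝓝[>] 0 ×ˢ 𝓝[>] 0, 0 < ε.2 → (∃ K : ℕ, 1 / ε.2 = K) →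
      ConcatenatedBound W R r ε.1 ε.2 a := by
  rcases le_or_gt a 0 with h0 | h0
  · exact Eventually.of_forall fun ε hε hK => W.concatenatedBound_of_lt hR hr hε hK (Or.inl h0)
  set E := W.gallagerExponent (R / r)
  have hE0 : 0 ≤ E := W.gallagerExponent_nonneg (div_pos hR hr)
  have hr' : 0 < 1 - r := by
    rcases (sub_nonneg.2 hr1).eq_or_lt with h | h
    · rw [← h] at ha
      simp only [EReal.coe_zero, zero_mul] at ha
      exact absurd (show a < 0 by exact_mod_cast ha) (not_lt.2 h0.le)
    · exact h
  have hlt : ((a / (1 - r) : ℝ) : EReal) < E := by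
    clear_value E
    induction E with
    | bot => exact absurd hE0 (by simp)
    | top => exact EReal.coe_lt_top _
    | coe E =>
      rw [← EReal.coe_mul, EReal.coe_lt_coe_iff] at ha
      rw [EReal.coe_lt_coe_iff, div_lt_iff₀ hr']
      linarith
  obtain ⟨t, h1, h2⟩ := EReal.lt_iff_exists_real_btwn.1 hlt
  have h1' : a / (1 - r) < t := EReal.coe_lt_coe_iff.1 h1
  have ht : 0 < t := lt_trans (by positivity) h1'
  rw [div_lt_iff₀ hr'] at h1'
  have hlim : Tendsto (fun ε : ℝ × ℝ => t * (1 - (ε.2 / 2 + (r + ε.1) * (1 - ε.2 / 2))))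
      (𝓝[>] 0 ×ˢ 𝓝[>] 0) (𝓝 (t * (1 - r))) := by
    have hc : Continuous fun ε : ℝ × ℝ => t * (1 - (ε.2 / 2 + (r + ε.1) * (1 - ε.2 / 2))) := by
      fun_prop
    have h3 := hc.tendsto ((0, 0) : ℝ × ℝ)
    simp only [zero_div, add_zero, sub_zero, mul_one, zero_add] at h3
    refine h3.mono_left ?_
    rw [nhds_prod_eq]
    exact Filter.prod_mono nhdsWithin_le_nhds nhdsWithin_le_nhds
  filter_upwards [hlim.eventually (lt_mem_nhds h1')] with ε hε hε2 hK
  refine W.concatenatedBound_of_lt hR hr hε2 hK (Or.inr ⟨t, ht, h2, ?_, hε⟩)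
  by_contra! hneg
  nlinarith

end MemorylessChannel

theorem theorem3 {X Y : Type*} [MeasurableSpace X] [MeasurableSpace Y]
    (W : MemorylessChannel X Y) (R : ℝ) (hR : 0 < R) (hRC : ENNReal.ofReal R < W.capacity) :
    (∃ e : ℝ → ℝ → ℝ,
      Tendsto (fun ε : ℝ × ℝ => ((e ε.1 ε.2 : ℝ) : EReal)) (𝓝[>] 0 ×ˢ 𝓝[>] 0)
        (𝓝 (W.forneyExponent R)) ∧
      ∀ ε₁ ε₂ : ℝ, 0 < ε₁ → 0 < ε₂ → (∃ K : ℕ, 1 / ε₂ = K) →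
        ∃ r, W.IsOuterRate R r ∧ ConcatenatedBound W R r ε₁ ε₂ (e ε₁ ε₂)) ∧
    ∀ r, W.IsOuterRate R r →
      ∃ e : ℝ → ℝ → ℝ,
        Tendsto (fun ε : ℝ × ℝ => ((e ε.1 ε.2 : ℝ) : EReal)) (𝓝[>] 0 ×ˢ 𝓝[>] 0)
          (𝓝 (((1 - r : ℝ) : EReal) * W.gallagerExponent (R / r))) ∧
        ∀ ε₁ ε₂ : ℝ, 0 < ε₁ → 0 < ε₂ → (∃ K : ℕ, 1 / ε₂ = K) →
          ConcatenatedBound W R r ε₁ ε₂ (e ε₁ ε₂) := by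
  have hX : Nonempty X := W.nonempty_of_capacity_pos (zero_le.trans_lt hRC)
  have hδ : Tendsto (fun ε : ℝ × ℝ => ε.1) (𝓝[>] (0 : ℝ) ×ˢ 𝓝[>] (0 : ℝ)) (𝓝[>] 0) := tendsto_fst
  have hrate : W.IsOuterRate R 1 := ⟨one_pos, le_rfl, by simpa using hRC.le⟩
  have hV : (0 : EReal) ≤ W.forneyExponent R := by
    refine le_trans (le_of_eq ?_) (le_iSup₂ (f := fun r (_ : r ∈ {r : ℝ | W.IsOuterRate R r}) =>
      ((1 - r : ℝ) : EReal) * W.gallagerExponent (R / r)) 1 hrate)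
    simp
  constructor
  · obtain ⟨e, he, hlim⟩ := exists_tendsto_of_eventually_exists_ge hδ
      (A := fun ε : ℝ × ℝ => {a : ℝ | (a : EReal) ≤ W.forneyExponent R ∧
        (0 < ε.2 → (∃ K : ℕ, 1 / ε.2 = K) →
          ∃ r, W.IsOuterRate R r ∧ ConcatenatedBound W R r ε.1 ε.2 a)})
      (V := W.forneyExponent R)
      (fun ε => ⟨0, by simpa using hV, fun hε hK =>
        ⟨1, hrate, W.concatenatedBound_of_lt hR one_pos hε hK (Or.inl le_rfl)⟩⟩)
      (fun ε a ha => ha.1)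
      (fun a ha => by
        obtain ⟨r, har⟩ := lt_iSup_iff.1 ha
        obtain ⟨hr, har⟩ := lt_iSup_iff.1 har
        filter_upwards [W.eventually_concatenatedBound_of_lt hR hr.1 hr.2.1 har] with ε hε
        exact ⟨a, ⟨ha.le, fun h2 hK => ⟨r, hr, hε h2 hK⟩⟩, le_rfl⟩)
    exact ⟨fun ε₁ ε₂ => e (ε₁, ε₂), hlim, fun ε₁ ε₂ _ h2 hK => (he (ε₁, ε₂)).2 h2 hK⟩
  · intro r hr
    have hV' : (0 : EReal) ≤ ((1 - r : ℝ) : EReal) * W.gallagerExponent (R / r) :=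
      mul_nonneg (by exact_mod_cast sub_nonneg.2 hr.2.1)
        (W.gallagerExponent_nonneg (div_pos hR hr.1))
    obtain ⟨e, he, hlim⟩ := exists_tendsto_of_eventually_exists_ge hδ
      (A := fun ε : ℝ × ℝ => {a : ℝ |
        (a : EReal) ≤ ((1 - r : ℝ) : EReal) * W.gallagerExponent (R / r) ∧
        (0 < ε.2 → (∃ K : ℕ, 1 / ε.2 = K) → ConcatenatedBound W R r ε.1 ε.2 a)})
      (V := ((1 - r : ℝ) : EReal) * W.gallagerExponent (R / r))
      (fun ε => ⟨0, by simpa using hV', fun hε hK =>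
        W.concatenatedBound_of_lt hR hr.1 hε hK (Or.inl le_rfl)⟩)
      (fun ε a ha => ha.1)
      (fun a ha => by
        filter_upwards [W.eventually_concatenatedBound_of_lt hR hr.1 hr.2.1 ha] with ε hε
        exact ⟨a, ⟨ha.le, hε⟩, le_rfl⟩)
    exact ⟨fun ε₁ ε₂ => e (ε₁, ε₂), hlim, fun ε₁ ε₂ _ h2 hK => (he (ε₁, ε₂)).2 h2 hK⟩
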